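/- **Setting.** A *model of $\mathrm{T}_{\mathrm{proc}}$* is a filtration $\mathcal N=(N_t)_{t\in[0,\infty]}$ of tracial von Neumann algebras (that is, a tracial von Neumann algebra $(N_\infty,\tau)$, with $\tau$ a faithful normal tracial state, and von Neumann subalgebras $N_s\subseteq N_t\subseteq N_\infty$ for $s\le t$) together with elements $z_{s,t,j}\in N_t$ ($0\le s\le t<\infty$, $j\in\mathbb N$) such that $\|z_{s,t,j}\|\le 6\sqrt{t-s}$ and $z_{t_1,t_2,j}+z_{t_2,t_3,j}=z_{t_1,t_3,j}$ for $t_1\le t_2\le t_3$. Let $D_{t,r}^{\mathcal N}$ be the closed operator-norm ball of radius $r$ in $N_t$, and $D_{0,\mathbf r}^{\mathcal N}=\prod_j D_{0,r_j}^{\mathcal N}$. Write $\langle\mathbf x,\mathbf y\rangle=\sum_j\tau(x_j^*y_j)$, $\|\mathbf x\|_2^2=\langle\mathbf x,\mathbf x\rangle$, $\|\mathbf x\|_1=\sum_j\tau(|x_j|)$, $q(\mathbf x)=\tfrac12\|\mathbf x\|_2^2$. *Terms* are built from variables, the constants $1$ and $z_{s,t,j}$, addition, multiplication, adjoint and scalar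 multiplication. *$\mathcal L_{\mathrm{proc}}$-formulas* are built from the basic formulas $\|a-b\|_2$, $\operatorname{Re}\tau(a)$, $\operatorname{Im}\tau(a)$ (with $a,b$ terms) by continuous connectives $f:\mathbb R^k\to\mathbb R$ and quantifiers $\sup_{y\in D_{t,r}}$, $\inf_{y\in D_{t,r}}$, where $t\in[0,\infty]$ and $r\in[0,\infty)$; they are evaluated in models in the obvious way. Define $\mathcal F_{\mathrm{chron}}(t)$, $t\in[0,\infty)$, recursively: basic formulas belong to every $\mathcal F_{\mathrm{chron}}(t)$; each $\mathcal F_{\mathrm{chron}}(t)$ is closed under continuous connectives; if $\varphi\in\mathcal F_{\mathrm{chron}}(t)$, $s\le t$ and $r>0$, then $\sup_{y\in D_{s,r}}\varphi$ and $\inf_{y\in D_{s,r}}\varphi$ are in $\mathcal F_{\mathrm{chron}}(s)$. *Chronological formulas* are the elements of $\bigcup_t\mathcal F_{\mathrm{chron}}(t)$. The shift $S_{t_0}\varphi$ of a formula $\varphi$ is obtained by replacing every $z_{s,t,j}$ by $z_{s+t_0,t+t_0,j}$ and every $D_{t,r}$ by $D_{t+t_0,r}$. A model is *stationary* (satisfies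 $\mathrm T_{\mathrm{stat}}$) if $(S_{t_0}\varphi)^{\mathcal N}(\mathbf x)=\varphi^{\mathcal N}(\mathbf x)$ for all chronological $\varphi$, all $t_0>0$ and all tuples $\mathbf x$ from $N_0$. A model $\mathcal M$ is *countably saturated* if for all countable tuples $\mathbf r$ of positive radii, all countable tuples $\mathbf y$ from $M_0$ and all sets $\Phi$ of $\mathcal L_{\mathrm{proc}}$-formulas: if for every finite $F\subseteq\Phi$ and $\varepsilon>0$ there is $\mathbf x\in D_{0,\mathbf r}^{\mathcal M}$ with $|\varphi^{\mathcal M}(\mathbf x,\mathbf y)|<\varepsilon$ for all $\varphi\in F$, then there is $\mathbf x\in D_{0,\mathbf r}^{\mathcal M}$ with $\varphi^{\mathcal M}(\mathbf x,\mathbf y)=0$ for all $\varphi\in\Phi$. The *chronological type* of a tuple is the map sending each chronological formula to its value at the tuple. $\mathbb S_{\mathrm{chron},m,\mathbf r}(\mathcal M/\mathbf y_0)$ is the set of chronological types $\operatorname{tp}_{\mathrm{chron}}^{\mathcal M}(\mathbf x,\mathbf y_0)$ of $\mathbf x\in D_{0,\mathbf r}^{\mathcal M}$. An *optimal coupling*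 of $(\mu_0,\mu_1)$ over $\mathbf y_0$ in $\mathcal M$ is a pair $\mathbf x_0,\mathbf x_1\in M_0^m$ with $\operatorname{tp}_{\mathrm{chron}}^{\mathcal M}(\mathbf x_j,\mathbf y_0)=\mu_j$ for which $\|\mathbf x_0-\mathbf x_1\|_2$ is minimal (equivalently, $\operatorname{Re}\langle\mathbf x_0,\mathbf x_1\rangle$ is maximal) among all such pairs. A *chronologically definable predicate with respect to $\mathrm T_{\mathrm{stat}}$* is a family of real functions $\varphi^{\mathcal N}$ of tuples from $N_0$, one for each stationary model $\mathcal N$, such that for every tuple $\mathbf r$ of positive radii and every $\varepsilon>0$ there is a chronological formula that is within $\varepsilon$ of $\varphi^{\mathcal N}$ on $D_{0,\mathbf r}^{\mathcal N}$ for all stationary models $\mathcal N$ simultaneously. **Theorem.** Let $\mathcal M$ be a countably saturated stationary model, let $m\in\mathbb N$, $m'\in\mathbb N\cup\{0,\infty\}$, $\mathbf y_0\in M_0^{m'}$ and $\mathbf r\in(0,\infty)^m$. For all $\mu_0,\mu_1\in\mathbb S_{\mathrm{chron},m,\mathbf r}(\mathcal M/\mathbf y_0)$ there exist chronologically definable predicates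 $\varphi_0,\varphi_1$ in $m+m'$ variables with respect to $\mathrm T_{\mathrm{stat}}$ such that: 1. for every stationary model $\mathcal N$, all $\mathbf x_0,\mathbf x_1\in N_0^m$ and all $\mathbf y\in N_0^{m'}$, $$\varphi_0^{\mathcal N}(\mathbf x_0,\mathbf y)+\varphi_1^{\mathcal N}(\mathbf x_1,\mathbf y)\ \ge\ \operatorname{Re}\langle\mathbf x_0,\mathbf x_1\rangle;$$ 2. $\varphi_0^{\mathcal M}(\mathbf x_0,\mathbf y_0)+\varphi_1^{\mathcal M}(\mathbf x_1,\mathbf y_0)=\operatorname{Re}\langle\mathbf x_0,\mathbf x_1\rangle$ whenever $(\mathbf x_0,\mathbf x_1)$ is an optimal coupling of $(\mu_0,\mu_1)$ over $\mathbf y_0$ in $\mathcal M$; 3. for $j=0,1$, $\varphi_j$ is convex in its first $m$ variables (in every stationary model, for every fixed $\mathbf y$), and $\varphi_j=\psi_j+q$ with $\psi_j$ a chronologically definable predicate that is Lipschitz with respect to $\|\cdot\|_1$ in the first $m$ variables, with a constant independent of the model and of $\mathbf y$. -/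

import Mathlib

open scoped NNReal ENNReal

universe u

noncomputable section

namespace NCProc

/-! ### Filtered tracial von Neumann algebras with a process -/

/-- A model of the theory of noncommutative filtrations in the language of filtered processes:
an increasing family of von Neumann algebras `M t`, `t ∈ [0,∞]`, on a Hilbert space `H`,
a faithful normal tracial state on `M ∞`, and elements `z s t j ∈ M t` for `0 ≤ s ≤ t < ∞`
with `‖z s t j‖ ≤ 6 √(t - s)`.

A normal (weak-* continuous) functional on `M ∞` is the restriction of a functional
`x ↦ ∑ₙ ⟪ξₙ, x ηₙ⟫` on `B(H)`; the field `τ` is such a functional, and it is only ever evaluated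
on `M ∞`.  Similarly `z s t j` is only used for `s ≤ t`. -/
structure FiltModel where
  /-- the Hilbert space on which the algebras act -/
  H : Type u
  [instNormedAddCommGroup : NormedAddCommGroup H]
  [instInnerProductSpace : InnerProductSpace ℂ H]
  [instCompleteSpace : CompleteSpace H]
  /-- the filtration, with `M ∞` the ambient algebra -/
  M : ℝ≥0∞ → VonNeumannAlgebra H
  mono : ∀ s t : ℝ≥0∞, s ≤ t → ∀ x ∈ M s, x ∈ M t
  /-- the trace -/
  τ : (H →L[ℂ] H) →ₗ[ℂ] ℂ
  normal : ∃ ξ η : ℕ → H, Summable (fun n => ‖ξ n‖ ^ 2) ∧ Summable (fun n => ‖η n‖ ^ 2) ∧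
    ∀ x : H →L[ℂ] H, τ x = ∑' n, inner ℂ (ξ n) (x (η n))
  unital : τ 1 = 1
  positive : ∀ x ∈ M ∞, 0 ≤ (τ (star x * x)).re ∧ (τ (star x * x)).im = 0
  tracial : ∀ x ∈ M ∞, ∀ y ∈ M ∞, τ (x * y) = τ (y * x)
  faithful : ∀ x ∈ M ∞, τ (star x * x) = 0 → x = 0
  /-- the increments of the process -/
  z : ℝ≥0 → ℝ≥0 → ℕ → (H →L[ℂ] H)
  z_mem : ∀ s t : ℝ≥0, s ≤ t → ∀ j, z s t j ∈ M t
  z_norm : ∀ s t : ℝ≥0, s ≤ t → ∀ j, ‖z s t j‖ ≤ 6 * Real.sqrt ((t : ℝ) - s)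

attribute [instance] FiltModel.instNormedAddCommGroup FiltModel.instInnerProductSpace
  FiltModel.instCompleteSpace

namespace FiltModel

variable (N : FiltModel.{u})

/-- Bounded operators on the underlying Hilbert space. -/
abbrev Op : Type u := N.H →L[ℂ] N.H

/-- The domain `D_{t,r}`: the closed operator-norm ball of radius `r` in `M t`. -/
def D (t : ℝ≥0∞) (r : ℝ≥0) : Set N.Op := {x | x ∈ N.M t ∧ ‖x‖ ≤ r}

/-- The tuples with entries in `M 0`. -/
def tuples (α : Type) : Set (α → N.Op) := {x | ∀ i, x i ∈ N.M 0}

/-- `⟨x, y⟩ = ∑ i, τ (xᵢ* yᵢ)`. -/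
def ip {ι : Type} [Fintype ι] (x y : ι → N.Op) : ℂ := ∑ i, N.τ (star (x i) * y i)

/-- `‖x‖₂` for a single element. -/
def norm2 (x : N.Op) : ℝ := Real.sqrt (N.τ (star x * x)).re

/-- `‖x‖₂` for a tuple. -/
def tupleNorm2 {ι : Type} [Fintype ι] (x : ι → N.Op) : ℝ := Real.sqrt (N.ip x x).re

/-- `‖x‖₁ = ∑ i, τ (|xᵢ|)` for a tuple, with `|x| = (x* x)^{1/2}`. -/
def tupleNorm1 {ι : Type} [Fintype ι] (x : ι → N.Op) : ℝ := ∑ i, (N.τ (CFC.abs (x i))).re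

/-- The function `q(x) = ‖x‖₂² / 2`. -/
def q {ι : Type} [Fintype ι] (x : ι → N.Op) : ℝ := N.tupleNorm2 x ^ 2 / 2

end FiltModel

/-! ### Terms and formulas -/

/-- Terms in variables from `V`. -/
inductive PTerm (V : Type) : Type
  | var (i : V) : PTerm V
  | plus (a b : PTerm V) : PTerm V
  | mul (a b : PTerm V) : PTerm V
  | adj (a : PTerm V) : PTerm V
  | smul (c : ℂ) (a : PTerm V) : PTerm V
  | one : PTerm V
  | z (s t : ℝ≥0) (h : s ≤ t) (j : ℕ) : PTerm V

/-- Formulas with free variables indexed by `α` and with `n` further variables, indexed by `Fin n`,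
that are to be bound by quantifiers.  A formula in the variables `α` is an element of
`PFormula α 0`; a quantifier binds the last of the `n + 1` variables. -/
inductive PFormula (α : Type) : ℕ → Type
  | dist {n : ℕ} (a b : PTerm (α ⊕ Fin n)) : PFormula α n
  | reTr {n : ℕ} (a : PTerm (α ⊕ Fin n)) : PFormula α n
  | imTr {n : ℕ} (a : PTerm (α ⊕ Fin n)) : PFormula α n
  | conn {n k : ℕ} (f : C(Fin k → ℝ, ℝ)) (φ : Fin k → PFormula α n) : PFormula α n
  | sup {n : ℕ} (t : ℝ≥0∞) (r : ℝ≥0) (φ : PFormula α (n + 1)) : PFormula α n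
  | inf {n : ℕ} (t : ℝ≥0∞) (r : ℝ≥0) (φ : PFormula α (n + 1)) : PFormula α n

/-- Interpretation of a term. -/
def PTerm.eval (N : FiltModel.{u}) {V : Type} (v : V → N.Op) : PTerm V → N.Op
  | .var i => v i
  | .plus a b => a.eval N v + b.eval N v
  | .mul a b => a.eval N v * b.eval N v
  | .adj a => star (a.eval N v)
  | .smul c a => c • a.eval N v
  | .one => 1
  | .z s t _ j => N.z s t j

/-- Interpretation of a formula, with `v` the values of the free variables and `w` those of the
variables that are still to be bound. -/
def PFormula.eval (N : FiltModel.{u}) {α : Type} (v : α → N.Op) :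
    {n : ℕ} → PFormula α n → (Fin n → N.Op) → ℝ
  | _, .dist a b, w => N.norm2 (a.eval N (Sum.elim v w) - b.eval N (Sum.elim v w))
  | _, .reTr a, w => (N.τ (a.eval N (Sum.elim v w))).re
  | _, .imTr a, w => (N.τ (a.eval N (Sum.elim v w))).im
  | _, .conn f φ, w => f fun i => (φ i).eval N v w
  | _, .sup t r φ, w => ⨆ y : N.D t r, φ.eval N v (Fin.snoc (α := fun _ => N.Op) w (y : N.Op))
  | _, .inf t r φ, w => ⨅ y : N.D t r, φ.eval N v (Fin.snoc (α := fun _ => N.Op) w (y : N.Op))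

/-- The value `φ^N(v)` of a formula in the variables `α`. -/
def PFormula.val (N : FiltModel.{u}) {α : Type} (φ : PFormula α 0) (v : α → N.Op) : ℝ :=
  φ.eval N v Fin.elim0

/-- The sets `F_chron(t)`, `t ∈ [0,∞)`: quantifiers occur in chronological order, quantifiers at
earlier times standing outside of those at later times. -/
inductive PFormula.ChronAt {α : Type} : {n : ℕ} → ℝ≥0 → PFormula α n → Prop
  | dist {n : ℕ} (t : ℝ≥0) (a b : PTerm (α ⊕ Fin n)) : ChronAt t (.dist a b)
  | reTr {n : ℕ} (t : ℝ≥0) (a : PTerm (α ⊕ Fin n)) : ChronAt t (.reTr a)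
  | imTr {n : ℕ} (t : ℝ≥0) (a : PTerm (α ⊕ Fin n)) : ChronAt t (.imTr a)
  | conn {n k : ℕ} (t : ℝ≥0) (f : C(Fin k → ℝ, ℝ)) (φ : Fin k → PFormula α n)
      (h : ∀ i, ChronAt t (φ i)) : ChronAt t (.conn f φ)
  | sup {n : ℕ} (s t : ℝ≥0) (hst : s ≤ t) (r : ℝ≥0) (hr : 0 < r) (φ : PFormula α (n + 1))
      (h : ChronAt t φ) : ChronAt s (.sup s r φ)
  | inf {n : ℕ} (s t : ℝ≥0) (hst : s ≤ t) (r : ℝ≥0) (hr : 0 < r) (φ : PFormula α (n + 1))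
      (h : ChronAt t φ) : ChronAt s (.inf s r φ)

/-- Chronological formulas. -/
def PFormula.IsChron {α : Type} {n : ℕ} (φ : PFormula α n) : Prop := ∃ t : ℝ≥0, φ.ChronAt t

/-- The time shift of terms. -/
def PTerm.shift (t₀ : ℝ≥0) {V : Type} : PTerm V → PTerm V
  | .var i => .var i
  | .plus a b => .plus (a.shift t₀) (b.shift t₀)
  | .mul a b => .mul (a.shift t₀) (b.shift t₀)
  | .adj a => .adj (a.shift t₀)
  | .smul c a => .smul c (a.shift t₀)
  | .one => .one
  | .z s t h j => .z (t₀ + s) (t₀ + t) (add_le_add_right h t₀) j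

/-- The time shift `S_{t₀}` of formulas. -/
def PFormula.shift (t₀ : ℝ≥0) {α : Type} : {n : ℕ} → PFormula α n → PFormula α n
  | _, .dist a b => .dist (a.shift t₀) (b.shift t₀)
  | _, .reTr a => .reTr (a.shift t₀)
  | _, .imTr a => .imTr (a.shift t₀)
  | _, .conn f φ => .conn f fun i => (φ i).shift t₀
  | _, .sup t r φ => .sup (t₀ + t) r (φ.shift t₀)
  | _, .inf t r φ => .inf (t₀ + t) r (φ.shift t₀)

/-! ### Stationarity, saturation, types, definable predicates -/

namespace FiltModel

variable (N : FiltModel.{u})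

/-- Additivity of the increments, i.e. the additional axioms of processes. -/
def IsProc : Prop :=
  ∀ t₁ t₂ t₃ : ℝ≥0, t₁ ≤ t₂ → t₂ ≤ t₃ → ∀ j, N.z t₁ t₂ j + N.z t₂ t₃ j = N.z t₁ t₃ j

/-- Stationarity: `S_{t₀} φ` and `φ` agree on tuples from `M 0` for all chronological `φ`.  (A
formula involves only finitely many of the variables in `α`.) -/
def IsStationary : Prop :=
  ∀ (α : Type) [Countable α] (φ : PFormula α 0), φ.IsChron → ∀ t₀ : ℝ≥0, 0 < t₀ →
    ∀ x ∈ N.tuples α, (φ.shift t₀).val N x = φ.val N x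

/-- Models of the theory of stationary processes. -/
def IsStatModel : Prop := N.IsProc ∧ N.IsStationary

/-- Countable saturation, for tuples in `M 0` indexed by countable sets. -/
def IsCountablySaturated : Prop :=
  ∀ (ι κ : Type) [Countable ι] [Countable κ] (Φ : Set (PFormula (ι ⊕ κ) 0))
    (r : ι → ℝ≥0), (∀ i, 0 < r i) → ∀ y ∈ N.tuples κ,
    (∀ F : Finset (PFormula (ι ⊕ κ) 0), ↑F ⊆ Φ → ∀ ε : ℝ, 0 < ε →
      ∃ x : ι → N.Op, (∀ i, x i ∈ N.D 0 (r i)) ∧ ∀ φ ∈ F, |φ.val N (Sum.elim x y)| < ε) →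
    ∃ x : ι → N.Op, (∀ i, x i ∈ N.D 0 (r i)) ∧ ∀ φ ∈ Φ, φ.val N (Sum.elim x y) = 0

end FiltModel

/-- Chronological formulas in the variables `α`, as a type. -/
def ChronFormula (α : Type) : Type := {φ : PFormula α 0 // φ.IsChron}

/-- The chronological type of a tuple. -/
def chronType (N : FiltModel.{u}) {α : Type} (x : α → N.Op) : ChronFormula α → ℝ :=
  fun φ => φ.1.val N x

/-- `S_{chron,ι,r}(M / y)`: the chronological types over `y` of tuples in `∏ i, D_{0,r i}`. -/
def typesOver (M : FiltModel.{u}) {ι κ : Type} (r : ι → ℝ≥0) (y : κ → M.Op) :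
    Set (ChronFormula (ι ⊕ κ) → ℝ) :=
  {μ | ∃ x : ι → M.Op, (∀ i, x i ∈ M.D 0 (r i)) ∧ chronType M (Sum.elim x y) = μ}

/-- `(x₀, x₁)` is a coupling of the types `(μ₀, μ₁)` over `y` in `M`. -/
def IsCoupling (M : FiltModel.{u}) {ι κ : Type} (y : κ → M.Op)
    (μ₀ μ₁ : ChronFormula (ι ⊕ κ) → ℝ) (x₀ x₁ : ι → M.Op) : Prop :=
  x₀ ∈ M.tuples ι ∧ x₁ ∈ M.tuples ι ∧
    chronType M (Sum.elim x₀ y) = μ₀ ∧ chronType M (Sum.elim x₁ y) = μ₁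

/-- The Wasserstein distance of types over `y` in `M`. -/
def wassersteinDist (M : FiltModel.{u}) {ι κ : Type} [Fintype ι] (y : κ → M.Op)
    (μ₀ μ₁ : ChronFormula (ι ⊕ κ) → ℝ) : ℝ :=
  sInf {d | ∃ x₀ x₁ : ι → M.Op, IsCoupling M y μ₀ μ₁ x₀ x₁ ∧ d = M.tupleNorm2 (x₀ - x₁)}

/-- Optimal couplings: those that attain the Wasserstein distance. -/
def IsOptimalCoupling (M : FiltModel.{u}) {ι κ : Type} [Fintype ι] (y : κ → M.Op)
    (μ₀ μ₁ : ChronFormula (ι ⊕ κ) → ℝ) (x₀ x₁ : ι → M.Op) : Prop :=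
  IsCoupling M y μ₀ μ₁ x₀ x₁ ∧ M.tupleNorm2 (x₀ - x₁) = wassersteinDist M y μ₀ μ₁

/-- A real-valued function of `α`-tuples in each model. -/
abbrev Predicate (α : Type) : Type (u + 1) := (N : FiltModel.{u}) → (α → N.Op) → ℝ

/-- `Φ` is a chronologically definable predicate with respect to the theory of stationary
processes: an element of the completion of the chronological formulas for the seminorms
`φ ↦ sup_N sup_{x ∈ D_{0,r}} |φ^N(x)|`.  Explicitly, for every tuple `r` of radii, `Φ` is a limit of
chronological formulas, uniformly on `D_{0,r}` and uniformly over all stationary models.  (Values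
outside of stationary models and of tuples in `M 0` are irrelevant.) -/
def IsChronDefinable {α : Type} (Φ : Predicate.{u} α) : Prop :=
  ∀ r : α → ℝ≥0, (∀ i, 0 < r i) → ∀ ε : ℝ, 0 < ε → ∃ φ : PFormula α 0, φ.IsChron ∧
    ∀ N : FiltModel.{u}, N.IsStatModel → ∀ x : α → N.Op, (∀ i, x i ∈ N.D 0 (r i)) →
      |Φ N x - φ.val N x| ≤ ε

/-- `Φ(x, y)` is convex in `x`, in every stationary model. -/
def IsConvexInFirst {ι κ : Type} (Φ : Predicate.{u} (ι ⊕ κ)) : Prop :=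
  ∀ N : FiltModel.{u}, N.IsStatModel → ∀ y ∈ N.tuples κ,
    ConvexOn ℝ (N.tuples ι) fun x => Φ N (Sum.elim x y)

/-- `Ψ(x, y)` is Lipschitz in `x` with respect to `‖·‖₁`, with a constant that is independent of
the stationary model and of `y`. -/
def IsLipschitzInFirst {ι κ : Type} [Fintype ι] (Ψ : Predicate.{u} (ι ⊕ κ)) : Prop :=
  ∃ L : ℝ, ∀ N : FiltModel.{u}, N.IsStatModel → ∀ y ∈ N.tuples κ,
    ∀ x ∈ N.tuples ι, ∀ x' ∈ N.tuples ι,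
      |Ψ N (Sum.elim x y) - Ψ N (Sum.elim x' y)| ≤ L * N.tupleNorm1 (x - x')

/-- `Φ = Ψ + q` on stationary models, for a chronologically definable `Ψ` that is Lipschitz with
respect to `‖·‖₁` in the first variables. -/
def IsLipschitzPlusQuadratic {ι κ : Type} [Fintype ι] (Φ : Predicate.{u} (ι ⊕ κ)) : Prop :=
  ∃ Ψ : Predicate.{u} (ι ⊕ κ), IsChronDefinable Ψ ∧ IsLipschitzInFirst Ψ ∧
    ∀ N : FiltModel.{u}, N.IsStatModel → ∀ x ∈ N.tuples ι, ∀ y ∈ N.tuples κ,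
      Φ N (Sum.elim x y) = Ψ N (Sum.elim x y) + N.q x

/-- The index set `{1, …, m}` for `m ∈ ℕ`, and `ℕ` for `m = ∞`. -/
abbrev Idx (m : ℕ∞) : Type := {j : ℕ // (j : ℕ∞) < m}

end NCProc

end

noncomputable section

namespace NCProc

/-! ### The trace -/

namespace FiltModel

variable (N : FiltModel.{u})

/-! This is Kantorovich duality, with potentials that must be uniform limits of chronological
formulas. Write `c` for the squared Wasserstein distance of `μ₀` and `μ₁`.

Saturation turns optimality into a definable inequality (`exists_penalty`,
`exists_definable_majorant`): there is a definable `g` that vanishes at realizations of `μ₀` and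
satisfies `c - ‖x₀ - x₁‖₂² ≤ g(x₀)` for all `x₀`, `x₁` in the ball with `x₁` of type `μ₁`. Put `Ψ(x)
= sup_{x₀} (c/2 - H(x - x₀) - g(x₀)/2)`, where the Huber function `H` equals `‖·‖₂²/2` on a large
operator-norm ball but is globally Lipschitz. Then `Ψ ≤ 0` at the second member of an optimal
coupling, while `Ψ(x) ≥ (c - ‖x - x₀‖₂²)/2` for its first member `x₀` (`exists_dual_potentials`).

The potentials are the first and second Legendre conjugates of `Ψ + q`. After completing the square,
the conjugate is `q` plus `sup_h (-‖h‖₂²/2 - Ψ(x + h))`. A priori this is a supremum over an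
unbounded set, so not visibly definable. If `Ψ` is `L`-Lipschitz for the norm dual to the operator
norm, truncating `h` to the ball of radius `L` loses nothing (`exists_truncation`,
`IsDualLipschitz.le_transform`). Hence the conjugate is definable and again `q` plus a Lipschitz
predicate. Convexity and the inequality in all models are Fenchel–Young; equality at an optimal
coupling follows from the two bounds on `Ψ`.

Quantifiers at time `0` may stand in front of any chronological formula, so suprema over balls of `M
0` preserve definability (`IsChronDefinable.supBall`). -/

theorem smul_mem_M {t : ℝ≥0∞} (c : ℂ) {a : N.Op} (ha : a ∈ N.M t) : c • a ∈ N.M t :=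
  (N.M t).toStarSubalgebra.smul_mem ha c

theorem real_smul_mem_M {t : ℝ≥0∞} (c : ℝ) {a : N.Op} (ha : a ∈ N.M t) : c • a ∈ N.M t := by
  have h : c • a = (c : ℂ) • a := by simp
  rw [h]
  exact N.smul_mem_M _ ha

theorem mem_M_of_commute {t : ℝ≥0∞} {x : N.Op}
    (h : ∀ y ∈ (N.M t).commutant, Commute x y) : x ∈ N.M t := by
  rw [← VonNeumannAlgebra.commutant_commutant (N.M t), VonNeumannAlgebra.mem_commutant_iff]
  exact fun g hg => (h g hg).symm.eq

theorem commute_of_mem_commutant {t : ℝ≥0∞} {a y : N.Op} (ha : a ∈ N.M t)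
    (hy : y ∈ (N.M t).commutant) : Commute a y :=
  VonNeumannAlgebra.mem_commutant_iff.1 hy a ha

/-- Bicommutant theorem: whatever commutes with `a` commutes with its functional calculus. No
continuity of `f` is needed, because the default value of `cfc` is `0`. -/
theorem cfc_mem_M {t : ℝ≥0∞} {a : N.Op} (ha : a ∈ N.M t) (f : ℝ → ℝ) : cfc f a ∈ N.M t :=
  N.mem_M_of_commute fun _ hy => (N.commute_of_mem_commutant ha hy).cfc_real f

theorem sqrt_mem_M {t : ℝ≥0∞} {a : N.Op} (ha : a ∈ N.M t) (h0 : 0 ≤ a) :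
    CFC.sqrt a ∈ N.M t := by
  rw [CFC.sqrt_eq_real_sqrt a, cfcₙ_eq_cfc]
  exact N.cfc_mem_M ha _

theorem abs_mem_M {t : ℝ≥0∞} {a : N.Op} (ha : a ∈ N.M t) : CFC.abs a ∈ N.M t :=
  N.sqrt_mem_M (mul_mem (star_mem ha) ha) (star_mul_self_nonneg a)

theorem tau_star_mul_self_nonneg {x : N.Op} (hx : x ∈ N.M ∞) : 0 ≤ (N.τ (star x * x)).re :=
  (N.positive x hx).1

/-- Polarization: `τ(a* a)` is real for `a = x`, `x + 1` and `x + i`, and the cross terms give the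
imaginary and real parts of the identity. -/
theorem tau_star {x : N.Op} (hx : x ∈ N.M ∞) : N.τ (star x) = (starRingEnd ℂ) (N.τ x) := by
  have h0 := (N.positive x hx).2
  have h1 := (N.positive (x + 1) (add_mem hx (one_mem _))).2
  have h2 := (N.positive (x + Complex.I • 1)
    (add_mem hx (N.smul_mem_M _ (one_mem _)))).2
  simp only [star_add, star_one, star_smul, mul_add, add_mul, map_add, one_mul, mul_one,
    N.unital, Complex.add_im, smul_mul_assoc, mul_smul_comm, map_smul, smul_eq_mul] at h1 h2
  simp at h1 h2
  apply Complex.ext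
  · simp only [Complex.conj_re]; linarith
  · simp only [Complex.conj_im]; linarith

theorem tau_star_re {x : N.Op} (hx : x ∈ N.M ∞) : (N.τ (star x)).re = (N.τ x).re := by
  rw [N.tau_star hx]; simp

theorem tau_nonneg_of_nonneg {a : N.Op} (ha : a ∈ N.M ∞) (h0 : 0 ≤ a) : 0 ≤ (N.τ a).re := by
  have h := N.tau_star_mul_self_nonneg (N.sqrt_mem_M ha h0)
  rwa [(CFC.sqrt_nonneg a).isSelfAdjoint.star_eq, CFC.sqrt_mul_sqrt_self a] at h

theorem tau_mono {a b : N.Op} (ha : a ∈ N.M ∞) (hb : b ∈ N.M ∞) (h : a ≤ b) :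
    (N.τ a).re ≤ (N.τ b).re := by
  have := N.tau_nonneg_of_nonneg (sub_mem hb ha) (sub_nonneg.2 h)
  simp only [map_sub, Complex.sub_re] at this
  linarith

theorem tau_mul_sq_le {a b : N.Op} (ha : a ∈ N.M ∞) (hb : b ∈ N.M ∞) :
    (N.τ (star (a * b) * (a * b))).re ≤ ‖a‖ ^ 2 * (N.τ (star b * b)).re := by
  have h1 : star (a * b) * (a * b) ≤ (‖a‖ ^ 2) • (star b * b) := by
    have h2 : star a * a ≤ algebraMap ℝ N.Op (‖a‖ ^ 2) :=
      CStarAlgebra.star_mul_le_algebraMap_norm_sq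
    have h3 := star_left_conjugate_le_conjugate h2 b
    simpa [mul_assoc, Algebra.algebraMap_eq_smul_one] using h3
  have h4 := N.tau_mono (mul_mem (star_mem (mul_mem ha hb)) (mul_mem ha hb))
    (N.real_smul_mem_M _ (mul_mem (star_mem hb) hb)) h1
  have h5 : (‖a‖ ^ 2) • (star b * b) = ((‖a‖ ^ 2 : ℝ) : ℂ) • (star b * b) :=
    (Complex.coe_smul _ _).symm
  rw [h5, map_smul, smul_eq_mul, Complex.re_ofReal_mul] at h4
  exact h4

theorem tau_sq_le {a : N.Op} (ha : a ∈ N.M ∞) : (N.τ (star a * a)).re ≤ ‖a‖ ^ 2 := by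
  simpa [N.unital] using N.tau_mul_sq_le ha (one_mem _)

/-- Positivity at `a - τ(a)` gives `|τ(a)|² ≤ τ(a* a)`. -/
theorem norm_tau_le {a : N.Op} (ha : a ∈ N.M ∞) : ‖N.τ a‖ ≤ ‖a‖ := by
  have h := N.tau_star_mul_self_nonneg
    (sub_mem ha (N.smul_mem_M (N.τ a) (one_mem _)))
  simp only [star_sub, star_one, star_smul, mul_sub, sub_mul, map_sub, one_mul, mul_one,
    N.unital, smul_mul_assoc, mul_smul_comm, map_smul, smul_eq_mul, N.tau_star ha] at h
  simp at h
  have h2 := N.tau_sq_le ha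
  refine abs_le_of_sq_le_sq' ?_ (norm_nonneg _) |>.2
  rw [Complex.sq_norm, Complex.normSq_apply]
  nlinarith

theorem norm2_le {a : N.Op} (ha : a ∈ N.M ∞) : N.norm2 a ≤ ‖a‖ :=
  Real.sqrt_le_iff.2 ⟨norm_nonneg _, N.tau_sq_le ha⟩

theorem eq_zero_of_norm2_eq_zero {a : N.Op} (ha : a ∈ N.M ∞) (h : N.norm2 a = 0) : a = 0 := by
  refine N.faithful a ha (Complex.ext ?_ (N.positive a ha).2)
  exact (Real.sqrt_eq_zero (N.positive a ha).1).1 h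

theorem two_mul_tau_le {a b : N.Op} (ha : a ∈ N.M ∞) (hb : b ∈ N.M ∞) :
    2 * (N.τ (star a * b)).re ≤ (N.τ (star a * a)).re + (N.τ (star b * b)).re := by
  have h := N.tau_star_mul_self_nonneg (sub_mem ha hb)
  have h2 : (N.τ (star b * a)).re = (N.τ (star a * b)).re := by
    rw [← N.tau_star_re (mul_mem (star_mem ha) hb)]; simp
  simp only [star_sub, mul_sub, sub_mul, map_sub, Complex.sub_re] at h
  linarith

-- Hölder's inequality without polar decomposition. With `s = |h|`, `b = (s + ε)^{1/2}` and `c =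
-- b⁻¹`, traciality gives `τ(u* h) = τ((ub)* (hc))`. The inequality `2 Re τ(x* y) ≤ τ(x* x) + τ(y*
-- y)` then suffices, since `τ((ub)* (ub)) ≤ τ(s) + ε` and `(hc)* (hc) = s² / (s + ε) ≤ s`.
set_option maxHeartbeats 1000000 in
theorem tau_star_mul_le_abs {u h : N.Op} (hu : u ∈ N.M ∞) (hu1 : ‖u‖ ≤ 1) (hh : h ∈ N.M ∞) :
    (N.τ (star u * h)).re ≤ (N.τ (CFC.abs h)).re := by
  refine le_of_forall_pos_le_add fun ε hε => ?_
  set s := CFC.abs h with hs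
  have hsM : s ∈ N.M ∞ := N.abs_mem_M hh
  have hs0 : 0 ≤ s := CFC.abs_nonneg h
  have hsa : IsSelfAdjoint s := hs0.isSelfAdjoint
  have hspec : ∀ t ∈ spectrum ℝ s, 0 ≤ t := fun t ht => spectrum_nonneg_of_nonneg hs0 ht
  have hpos : ∀ t ∈ spectrum ℝ s, 0 < t + ε := fun t ht => by linarith [hspec t ht]
  have hsq : ∀ t ∈ spectrum ℝ s, Real.sqrt (t + ε) ≠ 0 := fun t ht =>
    (Real.sqrt_pos.2 (hpos t ht)).ne'
  have c1 : ContinuousOn (fun t : ℝ => Real.sqrt (t + ε)) (spectrum ℝ s) := by fun_prop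
  have c2 : ContinuousOn (fun t : ℝ => (Real.sqrt (t + ε))⁻¹) (spectrum ℝ s) := c1.inv₀ hsq
  set b := cfc (fun t : ℝ => Real.sqrt (t + ε)) s with hb
  set c := cfc (fun t : ℝ => (Real.sqrt (t + ε))⁻¹) s with hc
  have hbM : b ∈ N.M ∞ := N.cfc_mem_M hsM _
  have hcM : c ∈ N.M ∞ := N.cfc_mem_M hsM _
  have hbs : star b = b := (cfc_predicate (R := ℝ) _ s).star_eq
  have hcs : star c = c := (cfc_predicate (R := ℝ) _ s).star_eq
  have hcb : c * b = 1 := by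
    rw [hc, hb, ← cfc_mul _ _ s c2 c1, ← cfc_one ℝ s]
    exact cfc_congr fun t ht => inv_mul_cancel₀ (hsq t ht)
  have hbb : b * b = s + algebraMap ℝ N.Op ε := by
    rw [hb, ← cfc_mul _ _ s c1 c1]
    have : cfc (fun t : ℝ => t + ε) s = s + algebraMap ℝ N.Op ε := by
      rw [cfc_add_const ε (fun t => t) s, cfc_id' ℝ s]
    rw [← this]
    exact cfc_congr fun t ht => Real.mul_self_sqrt (hpos t ht).le
  have hcsc : star (h * c) * (h * c) ≤ s := by
    have e1 : star (h * c) * (h * c) = c * (s * s) * c := by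
      rw [hs, CFC.abs_mul_abs, star_mul, hcs]; simp only [mul_assoc]
    have e2 : c * (s * s) * c
        = cfc (fun t : ℝ => (Real.sqrt (t + ε))⁻¹ * (t * t) * (Real.sqrt (t + ε))⁻¹) s := by
      have ct : ContinuousOn (fun t : ℝ => t) (spectrum ℝ s) := by fun_prop
      have ctt : ContinuousOn (fun t : ℝ => t * t) (spectrum ℝ s) := ct.mul ct
      have c3 : ContinuousOn (fun t : ℝ => (Real.sqrt (t + ε))⁻¹ * (t * t)) (spectrum ℝ s) :=
        c2.mul ctt
      rw [cfc_mul _ _ s c3 c2, cfc_mul _ _ s c2 ctt, cfc_mul _ _ s ct ct, cfc_id' ℝ s]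
    rw [e1, e2]
    conv_rhs => rw [← cfc_id' ℝ s]
    have ct : ContinuousOn (fun t : ℝ => t) (spectrum ℝ s) := by fun_prop
    refine cfc_mono (fun t ht => ?_) ((c2.mul (ct.mul ct)).mul c2) ct
    have h1 := hpos t ht
    have h2 := hspec t ht
    have h3 : (Real.sqrt (t + ε))⁻¹ * (t * t) * (Real.sqrt (t + ε))⁻¹ = t * t / (t + ε) := by
      have h4 := hsq t ht
      field_simp
      rw [Real.sq_sqrt h1.le]
    simp only [h3]
    rw [div_le_iff₀ h1]
    nlinarith
  have e : (N.τ (star u * h)).re = (N.τ (star (u * b) * (h * c))).re := by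
    have : star (u * b) * (h * c) = b * (star u * h * c) := by
      rw [star_mul, hbs]; simp only [mul_assoc]
    rw [this, N.tracial b hbM _ (mul_mem (mul_mem (star_mem hu) hh) hcM), mul_assoc, hcb, mul_one]
  have h1 := N.two_mul_tau_le (mul_mem hu hbM) (mul_mem hh hcM)
  have h2 := N.tau_mul_sq_le hu hbM
  have h3 := N.tau_mono (mul_mem (star_mem (mul_mem hh hcM)) (mul_mem hh hcM)) hsM hcsc
  have h4 : (N.τ (star b * b)).re = (N.τ s).re + ε := by
    rw [hbs, hbb, map_add]
    have : algebraMap ℝ N.Op ε = (ε : ℂ) • (1 : N.Op) := by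
      simp [Algebra.algebraMap_eq_smul_one]
    rw [this, map_smul, N.unital]; simp
  have h5 : 0 ≤ (N.τ (star b * b)).re := N.tau_star_mul_self_nonneg hbM
  have h6 : ‖u‖ ^ 2 * (N.τ (star b * b)).re ≤ 1 * (N.τ (star b * b)).re :=
    mul_le_mul_of_nonneg_right (pow_le_one₀ (norm_nonneg _) hu1) h5
  rw [e]
  linarith

/-! ### Tuples and their norms -/

variable {ι : Type}

/-- The tuples whose entries lie in the balls `D_{0,R i}`. -/
def ball (R : ι → ℝ≥0) : Set (ι → N.Op) := {x | ∀ i, x i ∈ N.D 0 (R i)}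

theorem ball_subset_tuples {R : ι → ℝ≥0} {x : ι → N.Op} (hx : x ∈ N.ball R) : x ∈ N.tuples ι :=
  fun i => (hx i).1

theorem zero_mem_ball (R : ι → ℝ≥0) : (0 : ι → N.Op) ∈ N.ball R :=
  fun i => ⟨zero_mem _, by simp⟩

instance ball_nonempty (R : ι → ℝ≥0) : Nonempty (N.ball R) := ⟨⟨0, N.zero_mem_ball R⟩⟩

theorem neg_mem_ball {R : ι → ℝ≥0} {x : ι → N.Op} (hx : x ∈ N.ball R) : -x ∈ N.ball R :=
  fun i => ⟨neg_mem (hx i).1, by simpa using (hx i).2⟩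

theorem smul_mem_ball {R : ℝ≥0} {x : ι → N.Op} (hx : x ∈ N.ball fun _ => (1 : ℝ≥0)) :
    (R : ℝ) • x ∈ N.ball fun _ => R := fun i => by
  refine ⟨N.real_smul_mem_M _ (hx i).1, ?_⟩
  have := (hx i).2
  simp only [Pi.smul_apply, norm_smul, Real.norm_eq_abs, NNReal.abs_eq]
  exact mul_le_of_le_one_right R.2 this

theorem segment_mem_ball {R : ι → ℝ≥0} {x y : ι → N.Op} (hx : x ∈ N.ball R) (hy : y ∈ N.ball R)
    {s : ℝ} (h0 : 0 ≤ s) (h1 : s ≤ 1) : x + s • (y - x) ∈ N.ball R := fun i => by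
  refine ⟨add_mem (hx i).1 (N.real_smul_mem_M _ (sub_mem (hy i).1 (hx i).1)), ?_⟩
  have e : (x + s • (y - x)) i = (1 - s) • x i + s • y i := by
    simp only [Pi.add_apply, Pi.smul_apply, Pi.sub_apply]; module
  rw [e]
  calc _ ≤ ‖(1 - s) • x i‖ + ‖s • y i‖ := norm_add_le _ _
    _ = (1 - s) * ‖x i‖ + s * ‖y i‖ := by
      rw [norm_smul, norm_smul, Real.norm_of_nonneg h0, Real.norm_of_nonneg (sub_nonneg.2 h1)]
    _ ≤ (1 - s) * R i + s * R i := by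
      have := (hx i).2
      have := (hy i).2
      have := sub_nonneg.2 h1
      gcongr
    _ = R i := by ring

theorem add_mem_tuples {x y : ι → N.Op} (hx : x ∈ N.tuples ι) (hy : y ∈ N.tuples ι) :
    x + y ∈ N.tuples ι := fun i => add_mem (hx i) (hy i)

theorem sub_mem_tuples {x y : ι → N.Op} (hx : x ∈ N.tuples ι) (hy : y ∈ N.tuples ι) :
    x - y ∈ N.tuples ι := fun i => sub_mem (hx i) (hy i)

theorem smul_mem_tuples {x : ι → N.Op} (c : ℝ) (hx : x ∈ N.tuples ι) :
    c • x ∈ N.tuples ι := fun i => N.real_smul_mem_M c (hx i)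

theorem convex_tuples : Convex ℝ (N.tuples ι) := fun _ hx _ hy a b _ _ _ =>
  N.add_mem_tuples (N.smul_mem_tuples a hx) (N.smul_mem_tuples b hy)

variable [Fintype ι]

/-- The real part of the inner product. -/
def rip (x y : ι → N.Op) : ℝ := (N.ip x y).re

theorem rip_add_left (x y w : ι → N.Op) : N.rip (x + y) w = N.rip x w + N.rip y w := by
  simp [rip, ip, add_mul, Finset.sum_add_distrib]

theorem rip_add_right (x y w : ι → N.Op) : N.rip w (x + y) = N.rip w x + N.rip w y := by
  simp [rip, ip, mul_add, Finset.sum_add_distrib]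

theorem rip_smul_left (c : ℝ) (x y : ι → N.Op) : N.rip (c • x) y = c * N.rip x y := by
  have : ∀ i, N.τ (star ((c • x) i) * y i) = (c : ℂ) * N.τ (star (x i) * y i) := fun i => by
    rw [Pi.smul_apply, star_smul, star_trivial, smul_mul_assoc, ← Complex.coe_smul, map_smul,
      smul_eq_mul]
  simp only [rip, ip, this, ← Finset.mul_sum, Complex.re_ofReal_mul]

theorem rip_smul_right (c : ℝ) (x y : ι → N.Op) : N.rip x (c • y) = c * N.rip x y := by
  have : ∀ i, N.τ (star (x i) * (c • y) i) = (c : ℂ) * N.τ (star (x i) * y i) := fun i => by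
    rw [Pi.smul_apply, mul_smul_comm, ← Complex.coe_smul, map_smul, smul_eq_mul]
  simp only [rip, ip, this, ← Finset.mul_sum, Complex.re_ofReal_mul]

theorem rip_neg_left (x y : ι → N.Op) : N.rip (-x) y = -N.rip x y := by
  simp [rip, ip]

theorem rip_neg_right (x y : ι → N.Op) : N.rip x (-y) = -N.rip x y := by
  simp [rip, ip]

theorem rip_sub_left (x y w : ι → N.Op) : N.rip (x - y) w = N.rip x w - N.rip y w := by
  rw [sub_eq_add_neg, rip_add_left, rip_neg_left, sub_eq_add_neg]

theorem rip_sub_right (x y w : ι → N.Op) : N.rip w (x - y) = N.rip w x - N.rip w y := by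
  rw [sub_eq_add_neg, rip_add_right, rip_neg_right, sub_eq_add_neg]

theorem mem_top_of_mem_zero {a : N.Op} (ha : a ∈ N.M 0) : a ∈ N.M ∞ := N.mono 0 ∞ zero_le _ ha

theorem rip_comm {x y : ι → N.Op} (hx : x ∈ N.tuples ι) (hy : y ∈ N.tuples ι) :
    N.rip x y = N.rip y x := by
  simp only [rip, ip, Complex.re_sum]
  refine Finset.sum_congr rfl fun i _ => ?_
  rw [← N.tau_star_re (N.mem_top_of_mem_zero (mul_mem (star_mem (hx i)) (hy i)))]
  simp

theorem rip_self_nonneg {x : ι → N.Op} (hx : x ∈ N.tuples ι) : 0 ≤ N.rip x x := by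
  simp only [rip, ip, Complex.re_sum]
  exact Finset.sum_nonneg fun i _ => N.tau_star_mul_self_nonneg (N.mem_top_of_mem_zero (hx i))

theorem rip_add_self {x y : ι → N.Op} (hx : x ∈ N.tuples ι) (hy : y ∈ N.tuples ι) :
    N.rip (x + y) (x + y) = N.rip x x + 2 * N.rip x y + N.rip y y := by
  rw [rip_add_left, rip_add_right, rip_add_right, N.rip_comm hy hx]; ring

theorem rip_sub_self {x y : ι → N.Op} (hx : x ∈ N.tuples ι) (hy : y ∈ N.tuples ι) :
    N.rip (x - y) (x - y) = N.rip x x - 2 * N.rip x y + N.rip y y := by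
  rw [rip_sub_left, rip_sub_right, rip_sub_right, N.rip_comm hy hx]; ring

theorem rip_le_of_mem_ball {x : ι → N.Op} {R : ι → ℝ≥0} (hx : x ∈ N.ball R) :
    N.rip x x ≤ ∑ i, (R i : ℝ) ^ 2 := by
  simp only [rip, ip, Complex.re_sum]
  refine Finset.sum_le_sum fun i _ => (N.tau_sq_le (N.mem_top_of_mem_zero (hx i).1)).trans ?_
  have := (hx i).2
  gcongr

theorem tupleNorm2_sq {x : ι → N.Op} (hx : x ∈ N.tuples ι) : N.tupleNorm2 x ^ 2 = N.rip x x :=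
  Real.sq_sqrt (N.rip_self_nonneg hx)

theorem q_eq {x : ι → N.Op} (hx : x ∈ N.tuples ι) : N.q x = N.rip x x / 2 := by
  rw [q, N.tupleNorm2_sq hx]

/-- The norm dual to the operator norm under the trace pairing. -/
def dualNorm (h : ι → N.Op) : ℝ :=
  ⨆ u : N.ball fun _ : ι => (1 : ℝ≥0), N.rip u.1 h

theorem rip_le_tupleNorm1 {u h : ι → N.Op} (hu : u ∈ N.ball fun _ => (1 : ℝ≥0))
    (hh : h ∈ N.tuples ι) : N.rip u h ≤ N.tupleNorm1 h := by
  simp only [rip, ip, Complex.re_sum, tupleNorm1]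
  exact Finset.sum_le_sum fun i _ => N.tau_star_mul_le_abs (N.mem_top_of_mem_zero (hu i).1)
    (by simpa using (hu i).2) (N.mem_top_of_mem_zero (hh i))

/-- All Lipschitz estimates are made for `dualNorm`, a supremum of pairings; this one-sided
comparison converts them to `‖·‖₁` at the end. -/
theorem dualNorm_le_tupleNorm1 {h : ι → N.Op} (hh : h ∈ N.tuples ι) :
    N.dualNorm h ≤ N.tupleNorm1 h := ciSup_le fun u => N.rip_le_tupleNorm1 u.2 hh

theorem rip_le_dualNorm {u h : ι → N.Op} (hu : u ∈ N.ball fun _ => (1 : ℝ≥0))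
    (hh : h ∈ N.tuples ι) : N.rip u h ≤ N.dualNorm h := by
  have hb : BddAbove (Set.range fun u : N.ball fun _ : ι => (1 : ℝ≥0) => N.rip u.1 h) :=
    ⟨N.tupleNorm1 h, by rintro _ ⟨u, rfl⟩; exact N.rip_le_tupleNorm1 u.2 hh⟩
  exact le_ciSup hb ⟨u, hu⟩

theorem rip_le_mul_dualNorm {L : ℝ≥0} {k h : ι → N.Op} (hk : k ∈ N.ball fun _ => L)
    (hh : h ∈ N.tuples ι) : N.rip k h ≤ L * N.dualNorm h := by
  rcases eq_or_ne L 0 with rfl | hL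
  · have : k = 0 := funext fun i => norm_le_zero_iff.1 (by simpa using (hk i).2)
    subst this
    simp [rip, ip]
  · have hL' : (0 : ℝ) < L := by positivity
    have hu : (L : ℝ)⁻¹ • k ∈ N.ball fun _ => (1 : ℝ≥0) := fun i => by
      refine ⟨N.real_smul_mem_M _ (hk i).1, ?_⟩
      rw [Pi.smul_apply, norm_smul, norm_inv, Real.norm_of_nonneg hL'.le, inv_mul_le_iff₀ hL']
      simpa using (hk i).2
    have := N.rip_le_dualNorm hu hh
    rw [rip_smul_left, inv_mul_le_iff₀ hL'] at this
    exact this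

/-- Approximate truncation: replacing `h` by a near-closest point of the operator-norm ball of
radius `L` decreases `‖h‖₂² / 2` by almost `L` times the dual norm of the difference. -/
theorem exists_truncation {h : ι → N.Op} (hh : h ∈ N.tuples ι) (L : ℝ≥0) {δ : ℝ} (hδ : 0 < δ) :
    ∃ k ∈ N.ball fun _ => L,
      N.rip k k / 2 + L * N.dualNorm (k - h) ≤ N.rip h h / 2 + δ := by
  set C : ℝ := ∑ _i : ι, ((2 * L : ℝ≥0) : ℝ) ^ 2 with hC
  have hC0 : 0 ≤ C := Finset.sum_nonneg fun i _ => by positivity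
  -- `k` will be a minimizer only up to `s²`. Moving from `k` by a fraction `s` towards a point of
  -- the ball then gives the variational inequality with error `s (1 + C) ≤ δ`, where `C` bounds `‖v
  -- - k‖₂²`.
  set s : ℝ := min 1 (δ / (1 + C)) with hs
  have hs0 : 0 < s := lt_min one_pos (by positivity)
  have hs1 : s ≤ 1 := min_le_left _ _
  have hsC : s * (1 + C) ≤ δ := by
    rw [← le_div_iff₀ (by positivity)]; exact min_le_right _ _
  set f : (N.ball fun _ : ι => L) → ℝ := fun k => N.rip (h - k.1) (h - k.1) with hf
  have hbdd : BddBelow (Set.range f) := ⟨0, by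
    rintro _ ⟨k, rfl⟩
    exact N.rip_self_nonneg (N.sub_mem_tuples hh (N.ball_subset_tuples k.2))⟩
  obtain ⟨⟨k, hk⟩, hkI⟩ : ∃ k, f k < (⨅ k, f k) + s ^ 2 :=
    exists_lt_of_ciInf_lt (by linarith [pow_pos hs0 2])
  have hkt := N.ball_subset_tuples hk
  have hhk := N.sub_mem_tuples hh hkt
  refine ⟨k, hk, ?_⟩
  -- The variational inequality of the nearest point, `Re ⟨v - k, h - k⟩ ≤ 0` up to `δ`, tested at
  -- `v = -L u`. The supremum over `u` produces `L` times the dual norm.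
  have hmain : ∀ u : N.ball fun _ : ι => (1 : ℝ≥0),
      (L : ℝ) * N.rip u.1 (k - h) ≤ N.rip k (h - k) + δ := by
    intro u
    set v : ι → N.Op := -((L : ℝ) • u.1) with hv
    have hvB : v ∈ N.ball fun _ => L := N.neg_mem_ball (N.smul_mem_ball u.2)
    have hw : v - k ∈ N.ball fun _ => 2 * L := fun i => by
      refine ⟨sub_mem (hvB i).1 (hk i).1, ?_⟩
      have h1 := (hvB i).2
      have h2 := (hk i).2
      have := norm_sub_le (v i) (k i)
      simp only [Pi.sub_apply]
      push_cast
      linarith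
    have hwt := N.ball_subset_tuples hw
    have h1 := ciInf_le hbdd ⟨_, N.segment_mem_ball hk hvB hs0.le hs1⟩
    have e1 : h - (k + s • (v - k)) = (h - k) - s • (v - k) := by abel
    simp only [hf] at h1 hkI
    rw [e1, N.rip_sub_self hhk (N.smul_mem_tuples s hwt), rip_smul_right, rip_smul_left,
      rip_smul_right, N.rip_comm hhk hwt] at h1
    have h2 := N.rip_le_of_mem_ball hw
    rw [← hC] at h2
    have h3 : 2 * s * N.rip (v - k) (h - k) ≤ s ^ 2 * (1 + C) := by nlinarith [pow_pos hs0 2]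
    have h4 : 2 * N.rip (v - k) (h - k) ≤ s * (1 + C) := by
      refine le_of_mul_le_mul_left ?_ hs0
      linarith
    have h5 : N.rip v (h - k) = L * N.rip u.1 (k - h) := by
      rw [hv, rip_neg_left, rip_smul_left, ← neg_sub h k, rip_neg_right]; ring
    rw [rip_sub_left, h5] at h4
    linarith
  have h6 : (L : ℝ) * N.dualNorm (k - h) ≤ N.rip k (h - k) + δ := by
    rw [dualNorm, Real.mul_iSup_of_nonneg L.coe_nonneg]
    exact ciSup_le hmain
  have h7 : N.rip h h = N.rip k k + 2 * N.rip k (h - k) + N.rip (h - k) (h - k) := by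
    rw [← N.rip_add_self hkt hhk]; simp
  have h8 := N.rip_self_nonneg hhk
  linarith

end FiltModel

/-! ### Substitution -/

/-- Substitution of terms for variables in a term. -/
def PTerm.subst {V W : Type} (σ : V → PTerm W) : PTerm V → PTerm W
  | .var i => σ i
  | .plus a b => .plus (a.subst σ) (b.subst σ)
  | .mul a b => .mul (a.subst σ) (b.subst σ)
  | .adj a => .adj (a.subst σ)
  | .smul c a => .smul c (a.subst σ)
  | .one => .one
  | .z s t h j => .z s t h j

theorem PTerm.eval_subst (N : FiltModel.{u}) {V W : Type} (σ : V → PTerm W) (v : W → N.Op)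
    (a : PTerm V) : (a.subst σ).eval N v = a.eval N fun i => (σ i).eval N v := by
  induction a with
  | var i => rfl
  | plus a b iha ihb => simp only [subst, eval, iha, ihb]
  | mul a b iha ihb => simp only [subst, eval, iha, ihb]
  | adj a iha => simp only [subst, eval, iha]
  | smul c a iha => simp only [subst, eval, iha]
  | one => rfl
  | z s t h j => rfl

/-- Extension of a substitution to `n` further variables, which stay the last ones. -/
def liftSubst {β γ : Type} {k : ℕ} (σ : β → PTerm (γ ⊕ Fin k)) (n : ℕ) :
    β ⊕ Fin n → PTerm (γ ⊕ Fin (k + n)) :=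
  Sum.elim
    (fun b => (σ b).subst (Sum.elim (fun c => .var (.inl c)) fun i => .var (.inr (i.castAdd n))))
    (fun i => .var (.inr (i.natAdd k)))

theorem eval_liftSubst (N : FiltModel.{u}) {β γ : Type} {k n : ℕ} (σ : β → PTerm (γ ⊕ Fin k))
    (v : γ → N.Op) (w : Fin k → N.Op) (w' : Fin n → N.Op) :
    (fun i => (liftSubst σ n i).eval N (Sum.elim v (Fin.append w w'))) =
      Sum.elim (fun b => (σ b).eval N (Sum.elim v w)) w' := by
  funext i
  rcases i with b | i
  · simp only [liftSubst, Sum.elim_inl, PTerm.eval_subst]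
    congr 1
    funext j
    rcases j with c | j <;> simp [PTerm.eval]
  · simp [liftSubst, PTerm.eval]

/-- Substitution of terms for the free variables of a formula.  The terms may contain `k` new
variables that are to be bound. -/
def PFormula.subst {β γ : Type} {k : ℕ} (σ : β → PTerm (γ ⊕ Fin k)) :
    {n : ℕ} → PFormula β n → PFormula γ (k + n)
  | n, .dist a b => .dist (a.subst (liftSubst σ n)) (b.subst (liftSubst σ n))
  | n, .reTr a => .reTr (a.subst (liftSubst σ n))
  | n, .imTr a => .imTr (a.subst (liftSubst σ n))
  | _, .conn f φ => .conn f fun i => (φ i).subst σ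
  | _, .sup t r φ => .sup t r (φ.subst σ)
  | _, .inf t r φ => .inf t r (φ.subst σ)

theorem PFormula.eval_subst (N : FiltModel.{u}) {β γ : Type} {k n : ℕ}
    (σ : β → PTerm (γ ⊕ Fin k)) (φ : PFormula β n) (v : γ → N.Op) (w : Fin k → N.Op)
    (w' : Fin n → N.Op) :
    (φ.subst σ).eval N v (Fin.append w w') =
      φ.eval N (fun b => (σ b).eval N (Sum.elim v w)) w' := by
  induction φ with
  | dist a b => simp only [subst, eval, PTerm.eval_subst, eval_liftSubst]
  | reTr a => simp only [subst, eval, PTerm.eval_subst, eval_liftSubst]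
  | imTr a => simp only [subst, eval, PTerm.eval_subst, eval_liftSubst]
  | conn f φ ih => simp only [subst, eval, ih]
  | sup t r φ ih =>
    simp only [subst, eval]
    refine iSup_congr fun y => ?_
    rw [← ih (Fin.snoc w' y.1), Fin.append_snoc]
  | inf t r φ ih =>
    simp only [subst, eval]
    refine iInf_congr fun y => ?_
    rw [← ih (Fin.snoc w' y.1), Fin.append_snoc]

theorem PFormula.ChronAt.subst {β γ : Type} {k n : ℕ} (σ : β → PTerm (γ ⊕ Fin k))
    {φ : PFormula β n} {t : ℝ≥0} (h : φ.ChronAt t) : (φ.subst σ).ChronAt t := by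
  induction h with
  | dist t a b => exact .dist _ _ _
  | reTr t a => exact .reTr _ _
  | imTr t a => exact .imTr _ _
  | conn t f φ h ih => exact .conn _ _ _ ih
  | sup s t hst r hr φ h ih => exact .sup s t hst r hr _ ih
  | inf s t hst r hr φ h ih => exact .inf s t hst r hr _ ih

theorem PFormula.IsChron.subst {β γ : Type} {k n : ℕ} (σ : β → PTerm (γ ⊕ Fin k))
    {φ : PFormula β n} (h : φ.IsChron) : (φ.subst σ).IsChron :=
  h.imp fun _ => PFormula.ChronAt.subst σ

theorem PFormula.val_subst (N : FiltModel.{u}) {β γ : Type} (σ : β → PTerm (γ ⊕ Fin 0))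
    (φ : PFormula β 0) (v : γ → N.Op) :
    PFormula.val N (φ.subst σ) v =
      φ.val N fun b => (σ b).eval N (Sum.elim v (Fin.elim0 : Fin 0 → N.Op)) := by
  unfold PFormula.val
  rw [← φ.eval_subst N σ v Fin.elim0 Fin.elim0]
  congr 1
  exact Subsingleton.elim _ _

theorem PFormula.eval_subst_zero (N : FiltModel.{u}) {β γ : Type} {k : ℕ}
    (σ : β → PTerm (γ ⊕ Fin k)) (φ : PFormula β 0) (v : γ → N.Op) (w : Fin k → N.Op) :
    PFormula.eval N v (n := k) (φ.subst σ) w =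
      φ.val N fun b => (σ b).eval N (Sum.elim v w) := by
  unfold PFormula.val
  rw [← φ.eval_subst N σ v w Fin.elim0]
  congr 1
  funext i
  exact (Fin.append_left w Fin.elim0 i).symm

/-! ### Boundedness -/

theorem FiltModel.D_subset_D_top (N : FiltModel.{u}) {t : ℝ≥0∞} {r : ℝ≥0} {x : N.Op}
    (hx : x ∈ N.D t r) : x ∈ N.D ∞ r := ⟨N.mono t ∞ le_top x hx.1, hx.2⟩

instance FiltModel.D_nonempty (N : FiltModel.{u}) (t : ℝ≥0∞) (r : ℝ≥0) : Nonempty (N.D t r) :=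
  ⟨⟨0, zero_mem _, by simp⟩⟩

theorem PTerm.exists_bound {V : Type} (a : PTerm V) (r : V → ℝ≥0) :
    ∃ C : ℝ≥0, ∀ (N : FiltModel.{u}) (v : V → N.Op), (∀ i, v i ∈ N.D ∞ (r i)) →
      a.eval N v ∈ N.D ∞ C := by
  induction a with
  | var i => exact ⟨r i, fun N v hv => hv i⟩
  | plus a b iha ihb =>
    obtain ⟨A, hA⟩ := iha
    obtain ⟨B, hB⟩ := ihb
    refine ⟨A + B, fun N v hv => ⟨add_mem (hA N v hv).1 (hB N v hv).1, ?_⟩⟩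
    exact (norm_add_le _ _).trans (add_le_add (hA N v hv).2 (hB N v hv).2)
  | mul a b iha ihb =>
    obtain ⟨A, hA⟩ := iha
    obtain ⟨B, hB⟩ := ihb
    refine ⟨A * B, fun N v hv => ⟨mul_mem (hA N v hv).1 (hB N v hv).1, ?_⟩⟩
    exact (norm_mul_le _ _).trans
      (mul_le_mul (hA N v hv).2 (hB N v hv).2 (norm_nonneg _) A.coe_nonneg)
  | adj a iha =>
    obtain ⟨A, hA⟩ := iha
    refine ⟨A, fun N v hv => ⟨star_mem (hA N v hv).1, ?_⟩⟩
    rw [eval, norm_star]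
    exact (hA N v hv).2
  | smul c a iha =>
    obtain ⟨A, hA⟩ := iha
    refine ⟨‖c‖₊ * A, fun N v hv => ⟨N.smul_mem_M c (hA N v hv).1, ?_⟩⟩
    rw [eval, norm_smul]
    exact mul_le_mul_of_nonneg_left (hA N v hv).2 (norm_nonneg _)
  | one =>
    refine ⟨1, fun N v _ => ⟨one_mem _, ?_⟩⟩
    exact ContinuousLinearMap.norm_id_le
  | z s t h j =>
    refine ⟨⟨6 * Real.sqrt ((t : ℝ) - s), by positivity⟩, fun N v _ => ⟨?_, N.z_norm s t h j⟩⟩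
    exact N.mono t ∞ le_top _ (N.z_mem s t h j)

/-- The bound is uniform over models. Real suprema of unbounded families have the default value `0`,
so every later use of `⨆` relies on such a bound. -/
theorem PFormula.exists_bound {α : Type} {n : ℕ} (φ : PFormula α n) (r : α → ℝ≥0)
    (R : Fin n → ℝ≥0) :
    ∃ C : ℝ, ∀ (N : FiltModel.{u}) (v : α → N.Op) (w : Fin n → N.Op),
      (∀ i, v i ∈ N.D ∞ (r i)) → (∀ i, w i ∈ N.D ∞ (R i)) → |φ.eval N v w| ≤ C := by
  have key : ∀ (N : FiltModel.{u}) {n : ℕ} (R : Fin n → ℝ≥0) (v : α → N.Op) (w : Fin n → N.Op),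
      (∀ i, v i ∈ N.D ∞ (r i)) → (∀ i, w i ∈ N.D ∞ (R i)) →
        ∀ i, Sum.elim v w i ∈ N.D ∞ (Sum.elim r R i) := by
    rintro N n R v w hv hw (i | i)
    exacts [hv i, hw i]
  have hsnoc : ∀ (N : FiltModel.{u}) {n : ℕ} (R : Fin n → ℝ≥0) (w : Fin n → N.Op) (t : ℝ≥0∞)
      (ρ : ℝ≥0) (y : N.D t ρ), (∀ i, w i ∈ N.D ∞ (R i)) →
        ∀ i, Fin.snoc (α := fun _ => N.Op) w y.1 i ∈
          N.D ∞ (Fin.snoc (α := fun _ => ℝ≥0) R ρ i) := by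
    intro N n R w t ρ y hw i
    refine Fin.lastCases ?_ (fun i => ?_) i
    · simpa using N.D_subset_D_top y.2
    · simpa using hw i
  induction φ with
  | dist a b =>
    obtain ⟨A, hA⟩ := a.exists_bound.{u} (Sum.elim r R)
    obtain ⟨B, hB⟩ := b.exists_bound.{u} (Sum.elim r R)
    refine ⟨A + B, fun N v w hv hw => ?_⟩
    have h1 := hA N _ (key N R v w hv hw)
    have h2 := hB N _ (key N R v w hv hw)
    rw [eval, abs_of_nonneg (show 0 ≤ N.norm2 _ from Real.sqrt_nonneg _)]
    exact (N.norm2_le (sub_mem h1.1 h2.1)).trans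
      ((norm_sub_le _ _).trans (add_le_add h1.2 h2.2))
  | reTr a =>
    obtain ⟨A, hA⟩ := a.exists_bound.{u} (Sum.elim r R)
    refine ⟨A, fun N v w hv hw => ?_⟩
    have h1 := hA N _ (key N R v w hv hw)
    exact (Complex.abs_re_le_norm _).trans ((N.norm_tau_le h1.1).trans h1.2)
  | imTr a =>
    obtain ⟨A, hA⟩ := a.exists_bound.{u} (Sum.elim r R)
    refine ⟨A, fun N v w hv hw => ?_⟩
    have h1 := hA N _ (key N R v w hv hw)
    exact (Complex.abs_im_le_norm _).trans ((N.norm_tau_le h1.1).trans h1.2)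
  | conn f φ ih =>
    choose C hC using fun i => ih i R
    obtain ⟨B, hB⟩ := (isCompact_univ_pi fun i => isCompact_Icc (a := -C i) (b := C i)
      ).exists_bound_of_continuousOn f.continuous.continuousOn
    exact ⟨B, fun N v w hv hw => hB _ fun i _ => abs_le.1 (hC i N v w hv hw)⟩
  | sup t ρ φ ih =>
    obtain ⟨C, hC⟩ := ih (Fin.snoc (α := fun _ => ℝ≥0) R ρ)
    refine ⟨C, fun N v w hv hw => ?_⟩
    have h : ∀ y : N.D t ρ, |φ.eval N v (Fin.snoc (α := fun _ => N.Op) w y.1)| ≤ C :=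
      fun y => hC N v _ hv (hsnoc N R w t ρ y hw)
    refine abs_le.2 ⟨?_, ciSup_le fun y => (abs_le.1 (h y)).2⟩
    exact le_ciSup_of_le ⟨C, by rintro _ ⟨y, rfl⟩; exact (abs_le.1 (h y)).2⟩
      (Classical.arbitrary _) (abs_le.1 (h _)).1
  | inf t ρ φ ih =>
    obtain ⟨C, hC⟩ := ih (Fin.snoc (α := fun _ => ℝ≥0) R ρ)
    refine ⟨C, fun N v w hv hw => ?_⟩
    have h : ∀ y : N.D t ρ, |φ.eval N v (Fin.snoc (α := fun _ => N.Op) w y.1)| ≤ C :=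
      fun y => hC N v _ hv (hsnoc N R w t ρ y hw)
    refine abs_le.2 ⟨le_ciInf fun y => (abs_le.1 (h y)).1, ?_⟩
    exact ciInf_le_of_le ⟨-C, by rintro _ ⟨y, rfl⟩; exact (abs_le.1 (h y)).1⟩
      (Classical.arbitrary _) (abs_le.1 (h _)).2

/-! ### Suprema over tuples -/

/-- The supremum of a formula over all of its further variables, ranging over balls in `M 0`. -/
def PFormula.supAll {α : Type} : {k : ℕ} → (Fin k → ℝ≥0) → PFormula α k → PFormula α 0
  | 0, _, φ => φ
  | k + 1, R, φ =>
    PFormula.supAll (fun i => R i.castSucc) (.sup ((0 : ℝ≥0) : ℝ≥0∞) (R (Fin.last k)) φ)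

theorem PFormula.IsChron.supAll {α : Type} {k : ℕ} {R : Fin k → ℝ≥0} (hR : ∀ i, 0 < R i)
    {φ : PFormula α k} (h : φ.IsChron) : (PFormula.supAll R φ).IsChron := by
  induction k with
  | zero => exact h
  | succ k ih =>
    obtain ⟨t, ht⟩ := h
    exact ih (fun i => hR _) ⟨0, .sup 0 t zero_le _ (hR _) _ ht⟩

/-- An iterated supremum is the joint supremum once everything is bounded. -/
theorem PFormula.isLUB_supAll {α : Type} {k : ℕ} (R : Fin k → ℝ≥0) (φ : PFormula α k)
    (N : FiltModel.{u}) (v : α → N.Op) (r : α → ℝ≥0) (hv : ∀ i, v i ∈ N.D ∞ (r i)) :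
    IsLUB ((fun w => φ.eval N v w) '' N.ball R) (PFormula.val N (PFormula.supAll R φ) v) := by
  induction k with
  | zero =>
    have : (fun w => φ.eval N v w) '' N.ball R = {φ.val N v} := by
      ext a
      simp only [Set.mem_image, Set.mem_singleton_iff, PFormula.val]
      constructor
      · rintro ⟨w, -, rfl⟩
        rw [Subsingleton.elim w Fin.elim0]
      · rintro rfl
        exact ⟨Fin.elim0, fun i => i.elim0, rfl⟩
    rw [this]
    exact isLUB_singleton
  | succ k ih =>
    have h1 := ih (fun i => R i.castSucc) (.sup ((0 : ℝ≥0) : ℝ≥0∞) (R (Fin.last k)) φ)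
    obtain ⟨C, hC⟩ := φ.exists_bound.{u} r R
    have hsnoc : ∀ (w : Fin k → N.Op), w ∈ N.ball (fun i => R i.castSucc) →
        ∀ y : N.D ((0 : ℝ≥0) : ℝ≥0∞) (R (Fin.last k)),
          Fin.snoc (α := fun _ => N.Op) w y.1 ∈ N.ball R := by
      intro w hw y i
      refine Fin.lastCases ?_ (fun i => ?_) i
      · simp
      · simpa using hw i
    have hb : ∀ w : Fin k → N.Op, w ∈ N.ball (fun i => R i.castSucc) →
        BddAbove (Set.range fun y : N.D ((0 : ℝ≥0) : ℝ≥0∞) (R (Fin.last k)) =>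
          φ.eval N v (Fin.snoc (α := fun _ => N.Op) w y.1)) := by
      rintro w hw
      refine ⟨C, ?_⟩
      rintro _ ⟨y, rfl⟩
      exact (abs_le.1 (hC N v _ hv fun i => N.D_subset_D_top (hsnoc w hw y i))).2
    constructor
    · rintro _ ⟨w, hw, rfl⟩
      have hw' : (fun i : Fin k => w i.castSucc) ∈ N.ball (fun i => R i.castSucc) :=
        fun i => hw _
      have hl : w (Fin.last k) ∈ N.D ((0 : ℝ≥0) : ℝ≥0∞) (R (Fin.last k)) := by
        simpa using hw (Fin.last k)
      refine le_trans ?_ (h1.1 ⟨_, hw', rfl⟩)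
      have h2 := le_ciSup (hb _ hw') ⟨_, hl⟩
      simp only [eval]
      refine le_trans (le_of_eq ?_) h2
      congr 1
      exact (Fin.snoc_init_self w).symm
    · intro b hb'
      refine h1.2 ?_
      rintro _ ⟨w, hw, rfl⟩
      simp only [eval]
      exact ciSup_le fun y => hb' ⟨_, hsnoc w hw y, rfl⟩

/-- Every chronological formula is equivalent to one that starts with a quantifier at time `0`. -/
theorem PFormula.IsChron.exists_chronAt_zero {α : Type} {φ : PFormula α 0} (h : φ.IsChron) :
    ∃ φ' : PFormula α 0, φ'.ChronAt 0 ∧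
      ∀ (N : FiltModel.{u}) (v : α → N.Op), φ'.val N v = φ.val N v := by
  obtain ⟨t, ht⟩ := h
  -- A dummy quantifier over a variable that does not occur. It serves to bring several formulas to
  -- the common time that `ChronAt.conn` demands.
  refine ⟨.sup ((0 : ℝ≥0) : ℝ≥0∞) 1 (φ.subst (k := 1) fun b => .var (.inl b)),
    .sup 0 t zero_le 1 one_pos _ (ht.subst _), fun N v => ?_⟩
  simp only [val, eval]
  rw [← ciSup_const (ι := N.D ((0 : ℝ≥0) : ℝ≥0∞) 1) (a := φ.eval N v Fin.elim0)]
  exact iSup_congr fun y => φ.eval_subst_zero N _ v _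

/-! ### Closure properties of definable predicates -/

theorem FiltModel.ball_subset_D_top (N : FiltModel.{u}) {ι : Type} {R : ι → ℝ≥0} {x : ι → N.Op}
    (hx : x ∈ N.ball R) (i : ι) : x i ∈ N.D ∞ (R i) := N.D_subset_D_top (hx i)

theorem FiltModel.exists_mem_ball (N : FiltModel.{u}) {ι : Type} {x : ι → N.Op}
    (hx : x ∈ N.tuples ι) : ∃ R : ι → ℝ≥0, (∀ i, 0 < R i) ∧ x ∈ N.ball R :=
  ⟨fun i => ‖x i‖₊ + 1, fun i => by positivity, fun i => ⟨hx i, by simp⟩⟩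

theorem FiltModel.elim_mem_ball (N : FiltModel.{u}) {α β : Type} {R : α → ℝ≥0} {S : β → ℝ≥0}
    {x : α → N.Op} {y : β → N.Op} (hx : x ∈ N.ball R) (hy : y ∈ N.ball S) :
    Sum.elim x y ∈ N.ball (Sum.elim R S) := by
  rintro (i | i)
  exacts [hx i, hy i]

theorem FiltModel.elim_mem_tuples (N : FiltModel.{u}) {α β : Type}
    {x : α → N.Op} {y : β → N.Op} (hx : x ∈ N.tuples α) (hy : y ∈ N.tuples β) :
    Sum.elim x y ∈ N.tuples (α ⊕ β) := by
  rintro (i | i)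
  exacts [hx i, hy i]

/-- The formula `f ∘ φ`. -/
def PFormula.map {α : Type} {n : ℕ} (f : C(ℝ, ℝ)) (φ : PFormula α n) : PFormula α n :=
  .conn (k := 1) ⟨fun a => f (a 0), by fun_prop⟩ fun _ => φ

/-- The sum of two formulas. -/
def PFormula.add {α : Type} {n : ℕ} (φ ψ : PFormula α n) : PFormula α n :=
  .conn (k := 2) ⟨fun a => a 0 + a 1, by fun_prop⟩ ![φ, ψ]

namespace IsChronDefinable

variable {α β : Type} {Φ Ψ : Predicate.{u} α}

theorem of_formula {φ : PFormula α 0} (h : φ.IsChron) :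
    IsChronDefinable (fun N : FiltModel.{u} => φ.val N) :=
  fun _ _ ε hε => ⟨φ, h, fun _ _ _ _ => by simpa using hε.le⟩

theorem of_approx (h : ∀ ε : ℝ, 0 < ε → ∃ Ψ : Predicate.{u} α, IsChronDefinable Ψ ∧
    ∀ N : FiltModel.{u}, N.IsStatModel → ∀ v ∈ N.tuples α, |Φ N v - Ψ N v| ≤ ε) :
    IsChronDefinable Φ := by
  intro r hr ε hε
  obtain ⟨Ψ, hΨ, h1⟩ := h (ε / 2) (half_pos hε)
  obtain ⟨φ, hφ, h2⟩ := hΨ r hr (ε / 2) (half_pos hε)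
  refine ⟨φ, hφ, fun N hN x hx => ?_⟩
  have := abs_sub_le (Φ N x) (Ψ N x) (φ.val N x)
  have := h1 N hN x (N.ball_subset_tuples hx)
  have := h2 N hN x hx
  linarith

theorem congr (hΦ : IsChronDefinable Φ)
    (h : ∀ N : FiltModel.{u}, N.IsStatModel → ∀ v ∈ N.tuples α, Ψ N v = Φ N v) :
    IsChronDefinable Ψ :=
  of_approx fun ε hε => ⟨Φ, hΦ, fun N hN v hv => by simpa [h N hN v hv] using hε.le⟩

theorem map {K : ℝ≥0} {f : ℝ → ℝ} (hf : LipschitzWith K f) (hΦ : IsChronDefinable Φ) :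
    IsChronDefinable fun N v => f (Φ N v) := by
  intro r hr ε hε
  obtain ⟨φ, ⟨t, ht⟩, h⟩ := hΦ r hr (ε / (K + 1)) (by positivity)
  refine ⟨φ.map ⟨f, hf.continuous⟩, ⟨t, .conn _ _ _ fun _ => ht⟩, fun N hN x hx => ?_⟩
  have h1 := hf.dist_le_mul (Φ N x) (φ.val N x)
  rw [Real.dist_eq, Real.dist_eq] at h1
  have h2 := h N hN x hx
  calc |f (Φ N x) - (φ.map ⟨f, hf.continuous⟩).val N x|
      ≤ K * |Φ N x - φ.val N x| := h1
    _ ≤ (K + 1) * (ε / (K + 1)) := by gcongr; linarith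
    _ = ε := by field_simp

theorem add (hΦ : IsChronDefinable Φ) (hΨ : IsChronDefinable Ψ) :
    IsChronDefinable fun N v => Φ N v + Ψ N v := by
  intro r hr ε hε
  obtain ⟨φ, hφ, h1⟩ := hΦ r hr (ε / 2) (half_pos hε)
  obtain ⟨ψ, hψ, h2⟩ := hΨ r hr (ε / 2) (half_pos hε)
  obtain ⟨φ', hφ', e1⟩ := hφ.exists_chronAt_zero.{u}
  obtain ⟨ψ', hψ', e2⟩ := hψ.exists_chronAt_zero.{u}
  refine ⟨φ'.add ψ', ⟨0, .conn _ _ _ fun i => ?_⟩, fun N hN x hx => ?_⟩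
  · fin_cases i
    exacts [hφ', hψ']
  · have e : (φ'.add ψ').val N x = φ'.val N x + ψ'.val N x := rfl
    have := abs_add_le (Φ N x - φ.val N x) (Ψ N x - ψ.val N x)
    have := h1 N hN x hx
    have := h2 N hN x hx
    rw [e, e1, e2, show Φ N x + Ψ N x - (φ.val N x + ψ.val N x)
      = (Φ N x - φ.val N x) + (Ψ N x - ψ.val N x) by ring]
    linarith

theorem const_mul (c : ℝ) (hΦ : IsChronDefinable Φ) : IsChronDefinable fun N v => c * Φ N v :=
  hΦ.map (lipschitzWith_smul c)

theorem neg (hΦ : IsChronDefinable Φ) : IsChronDefinable fun N v => -Φ N v :=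
  hΦ.map LipschitzWith.id.neg

theorem sub (hΦ : IsChronDefinable Φ) (hΨ : IsChronDefinable Ψ) :
    IsChronDefinable fun N v => Φ N v - Ψ N v := by
  simpa only [sub_eq_add_neg] using hΦ.add hΨ.neg

theorem const (c : ℝ) : IsChronDefinable fun (_ : FiltModel.{u}) (_ : α → _) => c :=
  (of_formula (φ := .reTr .one) ⟨0, .reTr _ _⟩).map (LipschitzWith.const c)

theorem sum {ι : Type} (s : Finset ι) {Φ : ι → Predicate.{u} α}
    (h : ∀ i ∈ s, IsChronDefinable (Φ i)) : IsChronDefinable fun N v => ∑ i ∈ s, Φ i N v := by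
  classical
  induction s using Finset.induction_on with
  | empty => simpa using const 0
  | insert a s ha ih =>
    simp only [Finset.sum_insert ha]
    exact (h a (Finset.mem_insert_self a s)).add
      (ih fun i hi => h i (Finset.mem_insert_of_mem hi))

theorem rip {ι : Type} [Fintype ι] (a b : ι → PTerm α) :
    IsChronDefinable fun (N : FiltModel.{u}) v =>
      N.rip (fun i => (a i).eval N v) fun i => (b i).eval N v := by
  let σ : α → PTerm (α ⊕ Fin 0) := fun i => .var (.inl i)
  refine (sum Finset.univ (Φ := fun i N v =>
    PFormula.val N (.reTr (.mul (.adj ((a i).subst σ)) ((b i).subst σ))) v)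
    fun i _ => of_formula ⟨0, .reTr _ _⟩).congr fun N hN v hv => ?_
  simp only [FiltModel.rip, FiltModel.ip, Complex.re_sum]
  refine Finset.sum_congr rfl fun i _ => ?_
  simp [PFormula.val, PFormula.eval, PTerm.eval, PTerm.eval_subst, σ]

theorem subst (hΦ : IsChronDefinable Φ) (σ : α → PTerm β)
    (hσ : ∀ (N : FiltModel.{u}), ∀ v ∈ N.tuples β, ∀ i, (σ i).eval N v ∈ N.M 0) :
    IsChronDefinable fun N v => Φ N fun i => (σ i).eval N v := by
  intro r hr ε hε
  choose C hC using fun i => (σ i).exists_bound.{u} r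
  obtain ⟨φ, hφ, h⟩ := hΦ (fun i => C i + 1) (fun i => by positivity) ε hε
  refine ⟨PFormula.subst (k := 0) (fun i => (σ i).subst fun j => .var (.inl j)) φ,
    hφ.subst _, fun N hN x hx => ?_⟩
  rw [PFormula.val_subst]
  simp only [PTerm.eval_subst, PTerm.eval, Sum.elim_inl]
  refine h N hN _ fun i => ⟨hσ N x (N.ball_subset_tuples hx) i, ?_⟩
  have := (hC i N x (N.ball_subset_D_top hx)).2
  push_cast
  linarith

theorem exists_bound (hΦ : IsChronDefinable Φ) {r : α → ℝ≥0} (hr : ∀ i, 0 < r i) :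
    ∃ C : ℝ, ∀ N : FiltModel.{u}, N.IsStatModel → ∀ v ∈ N.ball r, |Φ N v| ≤ C := by
  obtain ⟨φ, -, h⟩ := hΦ r hr 1 one_pos
  obtain ⟨C, hC⟩ := φ.exists_bound.{u} r Fin.elim0
  refine ⟨C + 1, fun N hN v hv => ?_⟩
  have h1 := h N hN v hv
  have h2 : |φ.val N v| ≤ C := hC N v _ (N.ball_subset_D_top hv) fun i => i.elim0
  have := abs_sub_abs_le_abs_sub (Φ N v) (φ.val N v)
  linarith

end IsChronDefinable

/-- The supremum of a predicate over the last `k` variables, ranging over balls in `M 0`. -/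
def supBall {γ : Type} {k : ℕ} (R : Fin k → ℝ≥0) (Φ : Predicate.{u} (γ ⊕ Fin k)) :
    Predicate.{u} γ :=
  fun N v => ⨆ h : N.ball R, Φ N (Sum.elim v h.1)

section

variable {γ : Type} {k : ℕ} {R : Fin k → ℝ≥0} {Φ : Predicate.{u} (γ ⊕ Fin k)}

theorem supBall_le {N : FiltModel.{u}} {v : γ → N.Op} {C : ℝ}
    (h : ∀ x ∈ N.ball R, Φ N (Sum.elim v x) ≤ C) : supBall R Φ N v ≤ C :=
  ciSup_le fun x => h x.1 x.2

theorem IsChronDefinable.le_supBall (hΦ : IsChronDefinable Φ) (hR : ∀ i, 0 < R i)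
    {N : FiltModel.{u}} (hN : N.IsStatModel) {v : γ → N.Op} (hv : v ∈ N.tuples γ)
    {x : Fin k → N.Op} (hx : x ∈ N.ball R) : Φ N (Sum.elim v x) ≤ supBall R Φ N v := by
  obtain ⟨r, hr, hvr⟩ := N.exists_mem_ball hv
  obtain ⟨C, hC⟩ := hΦ.exists_bound (r := Sum.elim r R) (by rintro (i | i); exacts [hr i, hR i])
  have hb : BddAbove (Set.range fun h : N.ball R => Φ N (Sum.elim v h.1)) := by
    refine ⟨C, ?_⟩
    rintro _ ⟨h, rfl⟩
    exact (abs_le.1 (hC N hN _ (N.elim_mem_ball hvr h.2))).2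
  exact le_ciSup hb ⟨x, hx⟩

/-- An approximation that is uniform on the ball passes to suprema with the same error. -/
theorem IsChronDefinable.supBall (hΦ : IsChronDefinable Φ) (hR : ∀ i, 0 < R i) :
    IsChronDefinable (supBall R Φ) := by
  intro r hr ε hε
  obtain ⟨φ, hφ, h⟩ := hΦ (Sum.elim r R) (by rintro (i | i); exacts [hr i, hR i]) ε hε
  let σ : γ ⊕ Fin k → PTerm (γ ⊕ Fin k) := .var
  refine ⟨PFormula.supAll R (PFormula.subst σ φ), (hφ.subst σ).supAll hR, fun N hN v hv => ?_⟩
  have hlub := PFormula.isLUB_supAll R (PFormula.subst σ φ) N v r (N.ball_subset_D_top hv)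
  have e : ∀ w : Fin k → N.Op,
      PFormula.eval N v (n := k) (PFormula.subst σ φ) w = φ.val N (Sum.elim v w) := fun w => by
    rw [PFormula.eval_subst_zero]; rfl
  have happ : ∀ w ∈ N.ball R, |Φ N (Sum.elim v w) - φ.val N (Sum.elim v w)| ≤ ε :=
    fun w hw => h N hN _ (N.elim_mem_ball hv hw)
  refine abs_le.2 ⟨?_, ?_⟩
  · rw [neg_le_sub_iff_le_add]
    refine hlub.2 ?_
    rintro _ ⟨w, hw, rfl⟩
    have h1 := hΦ.le_supBall hR hN (N.ball_subset_tuples hv) hw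
    have h2 := (abs_le.1 (happ w hw)).1
    simp only [e]
    linarith
  · rw [sub_le_iff_le_add]
    refine supBall_le fun w hw => ?_
    have h1 := hlub.1 ⟨w, hw, rfl⟩
    have h2 := (abs_le.1 (happ w hw)).2
    simp only [e] at h1
    linarith

end

/-! ### Lipschitz predicates and their conjugates -/

theorem FiltModel.dualNorm_sub_comm (N : FiltModel.{u}) {ι : Type} [Fintype ι] {x y : ι → N.Op}
    (hx : x ∈ N.tuples ι) (hy : y ∈ N.tuples ι) : N.dualNorm (x - y) = N.dualNorm (y - x) := by
  have key : ∀ {x y : ι → N.Op}, x ∈ N.tuples ι → y ∈ N.tuples ι →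
      N.dualNorm (x - y) ≤ N.dualNorm (y - x) := fun {x y} hx hy => ciSup_le fun u => by
    have := N.rip_le_dualNorm (N.neg_mem_ball u.2) (N.sub_mem_tuples hy hx)
    rwa [N.rip_neg_left, ← N.rip_neg_right, neg_sub] at this
  exact le_antisymm (key hx hy) (key hy hx)

variable {m : ℕ} {κ : Type}

/-- `Ψ(x, y)` is `L`-Lipschitz in `x` for the dual norm, in every stationary model. -/
def IsDualLipschitz (L : ℝ≥0) (Ψ : Predicate.{u} (Fin m ⊕ κ)) : Prop :=
  ∀ N : FiltModel.{u}, N.IsStatModel → ∀ y ∈ N.tuples κ,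
    ∀ x ∈ N.tuples (Fin m), ∀ x' ∈ N.tuples (Fin m),
      Ψ N (Sum.elim x y) ≤ Ψ N (Sum.elim x' y) + L * N.dualNorm (x - x')

theorem IsDualLipschitz.isLipschitzInFirst {L : ℝ≥0} {Ψ : Predicate.{u} (Fin m ⊕ κ)}
    (h : IsDualLipschitz L Ψ) : IsLipschitzInFirst Ψ := by
  refine ⟨L, fun N hN y hy x hx x' hx' => ?_⟩
  have h1 := h N hN y hy x hx x' hx'
  have h2 := h N hN y hy x' hx' x hx
  rw [N.dualNorm_sub_comm hx' hx] at h2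
  have h3 := mul_le_mul_of_nonneg_left
    (N.dualNorm_le_tupleNorm1 (N.sub_mem_tuples hx hx')) L.coe_nonneg
  exact abs_le.2 ⟨by linarith, by linarith⟩

/-- The function `(x, y, h) ↦ -‖h‖₂² / 2 - Ψ(x + h, y)`. -/
def transformKernel (Ψ : Predicate.{u} (Fin m ⊕ κ)) : Predicate.{u} ((Fin m ⊕ κ) ⊕ Fin m) :=
  fun N v => -(N.rip (fun i => v (.inr i)) fun i => v (.inr i)) / 2 -
    Ψ N (Sum.elim (fun i => v (.inl (.inl i)) + v (.inr i)) fun j => v (.inl (.inr j)))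

theorem transformKernel_elim (Ψ : Predicate.{u} (Fin m ⊕ κ)) (N : FiltModel.{u})
    (x h : Fin m → N.Op) (y : κ → N.Op) :
    transformKernel Ψ N (Sum.elim (Sum.elim x y) h) =
      -(N.rip h h) / 2 - Ψ N (Sum.elim (x + h) y) := rfl

/-- The function `(x, y) ↦ sup_h (-‖h‖₂² / 2 - Ψ(x + h, y))`, the supremum being taken over the
tuples of operators of norm at most `L`. -/
def transform (L : ℝ≥0) (Ψ : Predicate.{u} (Fin m ⊕ κ)) : Predicate.{u} (Fin m ⊕ κ) :=
  supBall (fun _ => L) (transformKernel Ψ)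

theorem IsChronDefinable.transformKernel {Ψ : Predicate.{u} (Fin m ⊕ κ)}
    (h : IsChronDefinable Ψ) : IsChronDefinable (transformKernel Ψ) := by
  have h1 := (IsChronDefinable.rip.{u} (α := (Fin m ⊕ κ) ⊕ Fin m) (fun i => .var (.inr i))
    fun i => .var (.inr i)).const_mul (-1 / 2)
  have h2 := h.subst (β := (Fin m ⊕ κ) ⊕ Fin m)
    (Sum.elim (fun i => .plus (.var (.inl (.inl i))) (.var (.inr i)))
      fun j => .var (.inl (.inr j))) (by
        rintro N v hv (i | j)
        exacts [add_mem (hv _) (hv _), hv _])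
  refine (h1.sub h2).congr fun N _ v _ => ?_
  have e : (fun i => (Sum.elim (fun i : Fin m => PTerm.plus (.var (.inl (.inl i)))
      (.var (.inr i))) (fun j : κ => PTerm.var (.inl (.inr j))) i).eval N v) =
      Sum.elim (fun i => v (.inl (.inl i)) + v (.inr i)) fun j => v (.inl (.inr j)) := by
    funext i
    rcases i with i | j <;> rfl
  rw [e]
  simp only [NCProc.transformKernel, PTerm.eval]
  ring

theorem IsChronDefinable.transform {L : ℝ≥0} (hL : 0 < L) {Ψ : Predicate.{u} (Fin m ⊕ κ)}
    (h : IsChronDefinable Ψ) : IsChronDefinable (transform L Ψ) :=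
  h.transformKernel.supBall fun _ => hL

section

variable {L : ℝ≥0} {Ψ : Predicate.{u} (Fin m ⊕ κ)} {N : FiltModel.{u}}
  {y : κ → N.Op} {x : Fin m → N.Op}

theorem le_transform_of_mem_ball (hL : 0 < L) (hΨ : IsChronDefinable Ψ) (hN : N.IsStatModel)
    (hy : y ∈ N.tuples κ) (hx : x ∈ N.tuples (Fin m)) {h : Fin m → N.Op}
    (hh : h ∈ N.ball fun _ => L) :
    -(N.rip h h) / 2 - Ψ N (Sum.elim (x + h) y) ≤ transform L Ψ N (Sum.elim x y) := by
  rw [← transformKernel_elim]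
  exact hΨ.transformKernel.le_supBall (fun _ => hL) hN (N.elim_mem_tuples hx hy) hh

theorem transform_le {C : ℝ}
    (h : ∀ k ∈ N.ball fun _ => L, -(N.rip k k) / 2 - Ψ N (Sum.elim (x + k) y) ≤ C) :
    transform L Ψ N (Sum.elim x y) ≤ C :=
  supBall_le h

/-- For `L`-Lipschitz `Ψ` the supremum defining the transform may be taken over all tuples. -/
theorem IsDualLipschitz.le_transform (hLip : IsDualLipschitz L Ψ) (hL : 0 < L)
    (hΨ : IsChronDefinable Ψ) (hN : N.IsStatModel) (hy : y ∈ N.tuples κ)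
    (hx : x ∈ N.tuples (Fin m)) {h : Fin m → N.Op} (hh : h ∈ N.tuples (Fin m)) :
    -(N.rip h h) / 2 - Ψ N (Sum.elim (x + h) y) ≤ transform L Ψ N (Sum.elim x y) := by
  refine le_of_forall_pos_le_add fun δ hδ => ?_
  obtain ⟨k, hk, h1⟩ := N.exists_truncation hh L hδ
  have hkt := N.ball_subset_tuples hk
  have h2 := le_transform_of_mem_ball hL hΨ hN hy hx hk
  have h3 := hLip N hN y hy _ (N.add_mem_tuples hx hkt) _ (N.add_mem_tuples hx hh)
  rw [add_sub_add_left_eq_sub] at h3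
  linarith

theorem IsDualLipschitz.transform (hLip : IsDualLipschitz L Ψ) (hL : 0 < L)
    (hΨ : IsChronDefinable Ψ) : IsDualLipschitz L (transform L Ψ) := by
  intro N hN y hy x hx x' hx'
  refine transform_le fun k hk => ?_
  have hkt := N.ball_subset_tuples hk
  have h1 := le_transform_of_mem_ball hL hΨ hN hy hx' hk
  have h2 := hLip N hN y hy _ (N.add_mem_tuples hx' hkt) _ (N.add_mem_tuples hx hkt)
  rw [add_sub_add_right_eq_sub, N.dualNorm_sub_comm hx' hx] at h2
  linarith

/-- Applying the transform twice does not increase a Lipschitz function. -/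
theorem transform_transform_le (hL : 0 < L) (hΨ : IsChronDefinable Ψ) (hN : N.IsStatModel)
    (hy : y ∈ N.tuples κ) (hx : x ∈ N.tuples (Fin m)) :
    NCProc.transform L (NCProc.transform L Ψ) N (Sum.elim x y) ≤ Ψ N (Sum.elim x y) := by
  refine transform_le fun k hk => ?_
  have h1 := le_transform_of_mem_ball hL hΨ hN hy
    (N.add_mem_tuples hx (N.ball_subset_tuples hk)) (N.neg_mem_ball hk)
  rw [N.rip_neg_left, N.rip_neg_right, neg_neg, add_neg_cancel_right] at h1
  linarith

end

/-- The predicate `Ψ + q`, with `q` a function of the first variables. -/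
def addQuadratic (Ψ : Predicate.{u} (Fin m ⊕ κ)) : Predicate.{u} (Fin m ⊕ κ) :=
  fun N v => Ψ N v + N.q fun i => v (.inl i)

theorem addQuadratic_elim {Ψ : Predicate.{u} (Fin m ⊕ κ)} {N : FiltModel.{u}}
    {x : Fin m → N.Op} (hx : x ∈ N.tuples (Fin m)) (y : κ → N.Op) :
    addQuadratic Ψ N (Sum.elim x y) = Ψ N (Sum.elim x y) + N.rip x x / 2 := by
  rw [← N.q_eq hx]
  rfl

theorem IsChronDefinable.addQuadratic {Ψ : Predicate.{u} (Fin m ⊕ κ)} (h : IsChronDefinable Ψ) :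
    IsChronDefinable (addQuadratic Ψ) := by
  have h1 := (IsChronDefinable.rip.{u} (α := Fin m ⊕ κ) (fun i => .var (.inl i))
    fun i => .var (.inl i)).const_mul (1 / 2)
  refine (h.add h1).congr fun N _ v hv => ?_
  rw [NCProc.addQuadratic, N.q_eq fun i => hv _]
  simp only [PTerm.eval]
  ring

theorem isLipschitzPlusQuadratic_addQuadratic {L : ℝ≥0} {Ψ : Predicate.{u} (Fin m ⊕ κ)}
    (hLip : IsDualLipschitz L Ψ) (h : IsChronDefinable Ψ) :
    IsLipschitzPlusQuadratic (addQuadratic Ψ) :=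
  ⟨Ψ, h, hLip.isLipschitzInFirst, fun _ _ _ _ _ _ => rfl⟩

/-- This predicate is the Legendre conjugate of `Ψ + q`, a supremum of the affine functions `w ↦ Re
⟨w, w'⟩ - q(w') - Ψ(w')`. The bound `key` is needed for arbitrary `w'`, beyond the ball of radius
`L` around `w`, which is where the Lipschitz condition enters. -/
theorem IsDualLipschitz.isConvexInFirst {L : ℝ≥0} {Ψ : Predicate.{u} (Fin m ⊕ κ)}
    (hLip : IsDualLipschitz L Ψ) (hL : 0 < L) (hΨ : IsChronDefinable Ψ) :
    IsConvexInFirst (addQuadratic (NCProc.transform L Ψ)) := by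
  intro N hN y hy
  refine ⟨N.convex_tuples, fun x hx x' hx' a b ha hb hab => ?_⟩
  have hxx := N.convex_tuples hx hx' ha hb hab
  have key : ∀ w ∈ N.tuples (Fin m), ∀ w' ∈ N.tuples (Fin m),
      N.rip w w' - N.rip w' w' / 2 - Ψ N (Sum.elim w' y) ≤
        addQuadratic (NCProc.transform L Ψ) N (Sum.elim w y) := by
    intro w hw w' hw'
    have h1 := hLip.le_transform hL hΨ hN hy hw (N.sub_mem_tuples hw' hw)
    rw [add_sub_cancel, N.rip_sub_self hw' hw, N.rip_comm hw' hw] at h1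
    rw [addQuadratic_elim hw]
    linarith
  simp only [smul_eq_mul]
  rw [addQuadratic_elim hxx, ← le_sub_iff_add_le]
  refine transform_le fun k hk => ?_
  have hkt := N.ball_subset_tuples hk
  set w := a • x + b • x' with hw
  have hwk := N.add_mem_tuples hxx hkt
  have h1 := mul_le_mul_of_nonneg_left (key x hx _ hwk) ha
  have h2 := mul_le_mul_of_nonneg_left (key x' hx' _ hwk) hb
  have h3 : N.rip w (w + k) = a * N.rip x (w + k) + b * N.rip x' (w + k) := by
    conv_lhs => rw [hw]
    rw [N.rip_add_left, N.rip_smul_left, N.rip_smul_left]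
  have h4 : N.rip w (w + k) = N.rip w w + N.rip w k := N.rip_add_right _ _ _
  have h5 := N.rip_add_self hxx hkt
  obtain rfl : b = 1 - a := by linarith
  linarith

/-! ### Huber functions -/

/-- The function `(x, y, x₀) ↦ sup_k (Re ⟨k, x - x₀⟩ - ‖k‖₂² / 2)`, the supremum being taken over
the tuples of operators of norm at most `L`. -/
def huber (L : ℝ≥0) : Predicate.{u} ((Fin m ⊕ κ) ⊕ Fin m) :=
  supBall (fun _ => L) fun N w =>
    N.rip (fun i : Fin m => w (.inr i)) (fun i => w (.inl (.inl (.inl i))) - w (.inl (.inr i))) -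
      N.rip (fun i : Fin m => w (.inr i)) (fun i => w (.inr i)) / 2

theorem isChronDefinable_huberKernel :
    IsChronDefinable fun (N : FiltModel.{u}) (w : ((Fin m ⊕ κ) ⊕ Fin m) ⊕ Fin m → N.Op) =>
      N.rip (fun i : Fin m => w (.inr i))
        (fun i => w (.inl (.inl (.inl i))) - w (.inl (.inr i))) -
      N.rip (fun i : Fin m => w (.inr i)) (fun i => w (.inr i)) / 2 := by
  have h1 := IsChronDefinable.rip.{u} (α := ((Fin m ⊕ κ) ⊕ Fin m) ⊕ Fin m)
    (fun i : Fin m => .var (.inr i))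
    fun i => .plus (.var (.inl (.inl (.inl i)))) (.smul (-1) (.var (.inl (.inr i))))
  have h2 := (IsChronDefinable.rip.{u} (α := ((Fin m ⊕ κ) ⊕ Fin m) ⊕ Fin m)
    (fun i : Fin m => .var (.inr i)) fun i => .var (.inr i)).const_mul (1 / 2)
  refine (h1.sub h2).congr fun N _ v _ => ?_
  simp only [PTerm.eval, neg_smul, one_smul, ← sub_eq_add_neg]
  ring

theorem isChronDefinable_huber {L : ℝ≥0} (hL : 0 < L) :
    IsChronDefinable (huber.{u} L : Predicate ((Fin m ⊕ κ) ⊕ Fin m)) :=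
  isChronDefinable_huberKernel.supBall fun _ => hL

section

variable {L : ℝ≥0} {N : FiltModel.{u}} {y : κ → N.Op} {x x' x₀ : Fin m → N.Op}

theorem le_huber (hL : 0 < L) (hN : N.IsStatModel) (hy : y ∈ N.tuples κ)
    (hx : x ∈ N.tuples (Fin m)) (hx₀ : x₀ ∈ N.tuples (Fin m)) {k : Fin m → N.Op}
    (hk : k ∈ N.ball fun _ => L) :
    N.rip k (x - x₀) - N.rip k k / 2 ≤ huber L N (Sum.elim (Sum.elim x y) x₀) :=
  isChronDefinable_huberKernel.le_supBall (R := fun _ => L) (fun _ => hL) hN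
    (N.elim_mem_tuples (N.elim_mem_tuples hx hy) hx₀) hk

theorem huber_le {C : ℝ} (h : ∀ k ∈ N.ball fun _ => L, N.rip k (x - x₀) - N.rip k k / 2 ≤ C) :
    huber L N (Sum.elim (Sum.elim x y) x₀) ≤ C :=
  supBall_le h

theorem huber_le_half_sq (hx : x ∈ N.tuples (Fin m)) (hx₀ : x₀ ∈ N.tuples (Fin m)) :
    huber L N (Sum.elim (Sum.elim x y) x₀) ≤ N.rip (x - x₀) (x - x₀) / 2 := by
  refine huber_le fun k hk => ?_
  have hkt := N.ball_subset_tuples hk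
  have h1 := N.rip_self_nonneg (N.sub_mem_tuples hkt (N.sub_mem_tuples hx hx₀))
  rw [N.rip_sub_self hkt (N.sub_mem_tuples hx hx₀)] at h1
  linarith

/-- The unrestricted maximizer `k = x - x₀` is then admissible. -/
theorem half_sq_le_huber (hL : 0 < L) (hN : N.IsStatModel) (hy : y ∈ N.tuples κ)
    (hx : x ∈ N.tuples (Fin m)) (hx₀ : x₀ ∈ N.tuples (Fin m))
    (h : x - x₀ ∈ N.ball fun _ => L) :
    N.rip (x - x₀) (x - x₀) / 2 ≤ huber L N (Sum.elim (Sum.elim x y) x₀) := by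
  have := le_huber hL hN hy hx hx₀ h
  linarith

theorem huber_le_add (hL : 0 < L) (hN : N.IsStatModel) (hy : y ∈ N.tuples κ)
    (hx : x ∈ N.tuples (Fin m)) (hx' : x' ∈ N.tuples (Fin m)) (hx₀ : x₀ ∈ N.tuples (Fin m)) :
    huber L N (Sum.elim (Sum.elim x y) x₀) ≤
      huber L N (Sum.elim (Sum.elim x' y) x₀) + L * N.dualNorm (x - x') := by
  refine huber_le fun k hk => ?_
  have h1 := le_huber hL hN hy hx' hx₀ hk
  have h2 := N.rip_le_mul_dualNorm hk (N.sub_mem_tuples hx hx')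
  rw [N.rip_sub_right] at h1 h2 ⊢
  linarith

end

/-! ### Penalty functions for types -/

theorem isChronDefinable_tsum {α : Type} {a : ℕ → ℝ} (ha : Summable a)
    {p : ℕ → Predicate.{u} α} (hp : ∀ n, IsChronDefinable (p n)) (h0 : ∀ n N v, 0 ≤ p n N v)
    (hpa : ∀ n N v, p n N v ≤ a n) : IsChronDefinable fun N v => ∑' n, p n N v := by
  refine IsChronDefinable.of_approx fun ε hε => ?_
  -- Weierstrass M-test: the tails are small uniformly over models and tuples.
  obtain ⟨n, hn⟩ := ((tendsto_sum_nat_add a).eventually (gt_mem_nhds hε)).exists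
  refine ⟨_, IsChronDefinable.sum (Finset.range n) fun i _ => hp i, fun N _ v _ => ?_⟩
  have hs : Summable fun n => p n N v := ha.of_nonneg_of_le (fun n => h0 n N v) fun n => hpa n N v
  rw [← hs.sum_add_tsum_nat_add n, add_sub_cancel_left,
    abs_of_nonneg (tsum_nonneg fun k => h0 _ _ _)]
  refine le_trans ?_ hn.le
  exact ((summable_nat_add_iff n).2 hs).tsum_le_tsum (fun k => hpa _ _ _)
    ((summable_nat_add_iff n).2 ha)

/-- Membership in an operator-norm ball is determined by the chronological type. -/
theorem mem_ball_of_chronType_eq {M : FiltModel.{u}} (hsat : M.IsCountablySaturated) {m : ℕ}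
    {κ : Type} {r : Fin m → ℝ≥0} (hr : ∀ i, 0 < r i) {y : κ → M.Op} {x x' : Fin m → M.Op}
    (hx : x ∈ M.ball r) (hx' : x' ∈ M.tuples (Fin m))
    (h : chronType M (Sum.elim x' y) = chronType M (Sum.elim x y)) : x' ∈ M.ball r := by
  intro i
  -- The `‖·‖₂`-distance to the ball is a chronological formula, so it vanishes at `x' i` too;
  -- saturation then makes the infimum attained.
  let φ : PFormula (Fin m ⊕ κ) 0 :=
    .inf ((0 : ℝ≥0) : ℝ≥0∞) (r i) (.dist (.var (.inl (.inl i))) (.var (.inr (Fin.last 0))))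
  have hφ : φ.IsChron := ⟨0, .inf 0 0 le_rfl _ (hr i) _ (.dist _ _ _)⟩
  have hval : ∀ w : Fin m → M.Op, φ.val M (Sum.elim w y) =
      ⨅ z : M.D ((0 : ℝ≥0) : ℝ≥0∞) (r i), M.norm2 (w i - z.1) := fun w => by
    refine iInf_congr fun z => ?_
    simp only [PFormula.eval, PTerm.eval, Sum.elim_inl, Sum.elim_inr, Fin.snoc_last]
  have h1 : φ.val M (Sum.elim x' y) = φ.val M (Sum.elim x y) := congr_fun h ⟨φ, hφ⟩
  have h2 : φ.val M (Sum.elim x y) ≤ 0 := by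
    rw [hval]
    refine ciInf_le_of_le ⟨0, ?_⟩ ⟨x i, by simpa using hx i⟩ ?_
    · rintro _ ⟨z, rfl⟩
      exact Real.sqrt_nonneg _
    · simp [FiltModel.norm2]
  let ψ : PFormula (Unit ⊕ Fin m) 0 := .dist (.var (.inl (.inr i))) (.var (.inl (.inl ())))
  have hψ : ∀ z : Unit → M.Op, ψ.val M (Sum.elim z x') = M.norm2 (x' i - z ()) := fun z => rfl
  obtain ⟨z, hz, hz0⟩ := hsat Unit (Fin m) {ψ} (fun _ => r i) (fun _ => hr i) x' hx'
    fun F hF ε hε => by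
      have h3 : φ.val M (Sum.elim x' y) < ε := by linarith
      rw [hval] at h3
      obtain ⟨z, hz⟩ := exists_lt_of_ciInf_lt h3
      refine ⟨fun _ => z.1, fun _ => by simp, fun φ' hφ' => ?_⟩
      obtain rfl : φ' = ψ := hF hφ'
      rw [hψ, abs_of_nonneg (show 0 ≤ M.norm2 _ from Real.sqrt_nonneg _)]
      exact hz
  have h4 := hz0 ψ rfl
  rw [hψ] at h4
  have h5 := M.eq_zero_of_norm2_eq_zero
    (sub_mem (M.mem_top_of_mem_zero (hx' i)) (M.mem_top_of_mem_zero (hz ()).1)) h4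
  rw [sub_eq_zero.1 h5]
  exact hz ()

section

variable {M : FiltModel.{u}} {m : ℕ} {κ : Type} {y₀ : κ → M.Op} {r : Fin m → ℝ≥0}
  {μ₀ μ₁ : ChronFormula (Fin m ⊕ κ) → ℝ} {c : ℝ}

/-- If `c` is a lower bound of `‖x₀ - x₁‖₂²` over all couplings, then it is almost a lower bound
when the type of `x₀` is close to `μ₀`. -/
theorem exists_penalty [Countable κ] (hsat : M.IsCountablySaturated) (hr : ∀ i, 0 < r i)
    (hy₀ : y₀ ∈ M.tuples κ)
    (hc : ∀ x₀ x₁, IsCoupling M y₀ μ₀ μ₁ x₀ x₁ → c ≤ M.rip (x₀ - x₁) (x₀ - x₁))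
    {ε : ℝ} (hε : 0 < ε) :
    ∃ p : Predicate.{u} (Fin m ⊕ κ), IsChronDefinable p ∧ (∀ N v, 0 ≤ p N v) ∧
      (∀ x, chronType M (Sum.elim x y₀) = μ₀ → p M (Sum.elim x y₀) = 0) ∧
      ∀ x₀ ∈ M.ball r, ∀ x₁ ∈ M.ball r, chronType M (Sum.elim x₁ y₀) = μ₁ →
        p M (Sum.elim x₀ y₀) < 1 → c - M.rip (x₀ - x₁) (x₀ - x₁) ≤ ε := by
  classical
  -- If every candidate `p` fails, the conditions "`x₀` has type `μ₀`, `x₁` has type `μ₁`, `‖x₀ -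
  -- x₁‖₂² ≤ c - ε`" are finitely satisfiable. A realization is a coupling that violates `hc`.
  by_contra! hcon
  let σ (f : Fin m → Fin m ⊕ Fin m) :
      Fin m ⊕ κ → PTerm (((Fin m ⊕ Fin m) ⊕ κ) ⊕ Fin 0) :=
    Sum.elim (fun i => .var (.inl (.inl (f i)))) fun j => .var (.inl (.inr j))
  let A (f : Fin m → Fin m ⊕ Fin m) (μ : ChronFormula (Fin m ⊕ κ) → ℝ)
      (φ : ChronFormula (Fin m ⊕ κ)) : PFormula ((Fin m ⊕ Fin m) ⊕ κ) 0 :=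
    PFormula.map ⟨fun a => a - μ φ, by fun_prop⟩ (PFormula.subst (σ f) φ.1)
  have hA : ∀ f μ φ (x : Fin m ⊕ Fin m → M.Op), (A f μ φ).val M (Sum.elim x y₀) =
      φ.1.val M (Sum.elim (fun i => x (f i)) y₀) - μ φ := by
    intro f μ φ x
    change PFormula.val M (PFormula.subst (σ f) φ.1) _ - μ φ = _
    rw [PFormula.val_subst]
    congr 2
    funext b
    rcases b with i | j <;> rfl
  let d (i : Fin m) : PTerm (((Fin m ⊕ Fin m) ⊕ κ) ⊕ Fin 0) :=
    .plus (.var (.inl (.inl (.inl i)))) (.smul (-1) (.var (.inl (.inl (.inr i)))))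
  let B : PFormula ((Fin m ⊕ Fin m) ⊕ κ) 0 :=
    .conn (k := m) ⟨fun a => max 0 ((∑ i, a i) - (c - ε)), by fun_prop⟩
      fun i => .reTr (.mul (.adj (d i)) (d i))
  have hB : ∀ x₀ x₁ : Fin m → M.Op, B.val M (Sum.elim (Sum.elim x₀ x₁) y₀) =
      max 0 (M.rip (x₀ - x₁) (x₀ - x₁) - (c - ε)) := by
    intro x₀ x₁
    simp only [FiltModel.rip, FiltModel.ip, Complex.re_sum]
    change max 0 ((∑ i, _) - (c - ε)) = _
    simp [d, PFormula.eval, PTerm.eval, sub_eq_add_neg]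
  obtain ⟨x, hxD, hx⟩ := hsat (Fin m ⊕ Fin m) κ
    (insert B (Set.range (A .inl μ₀) ∪ Set.range (A .inr μ₁))) (Sum.elim r r)
    (by rintro (i | i) <;> exact hr i) y₀ hy₀ fun F hF δ hδ => by
      have : Nonempty (ChronFormula (Fin m ⊕ κ)) := ⟨⟨.reTr .one, 0, .reTr _ _⟩⟩
      let F₀ := F.image (Function.invFun (A .inl μ₀))
      obtain ⟨x₀, hx₀, x₁, hx₁, ht, hp, hlt⟩ := hcon
        -- A value below `1` forces every `φ ∈ F₀` to be within `δ` of `μ₀ φ`.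
        (fun N v => ∑ φ ∈ F₀, δ⁻¹ * |φ.1.val N v + -μ₀ φ|)
        (IsChronDefinable.sum _ fun φ _ => IsChronDefinable.const_mul _
          (IsChronDefinable.map lipschitzWith_one_norm
            ((IsChronDefinable.of_formula φ.2).add (IsChronDefinable.const _))))
        (fun N v => Finset.sum_nonneg fun φ _ => by positivity)
        (fun x hx => Finset.sum_eq_zero fun φ _ => by
          have : φ.1.val M (Sum.elim x y₀) = μ₀ φ := congr_fun hx φ
          simp [this])
      refine ⟨Sum.elim x₀ x₁, ?_, fun f hf => ?_⟩
      · rintro (i | i)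
        exacts [hx₀ i, hx₁ i]
      · rcases hF hf with rfl | hf' | ⟨φ, rfl⟩
        · rw [hB, max_eq_left (by linarith)]
          simpa using hδ
        · have e := Function.invFun_eq hf'
          have hmem : Function.invFun (A .inl μ₀) f ∈ F₀ := Finset.mem_image_of_mem _ hf
          rw [← e, hA]
          have h1 := Finset.single_le_sum
            (f := fun φ : ChronFormula (Fin m ⊕ κ) =>
              δ⁻¹ * |φ.1.val M (Sum.elim x₀ y₀) + -μ₀ φ|)
            (fun φ _ => by positivity) hmem
          have h2 := h1.trans_lt hp
          rw [inv_mul_lt_iff₀ hδ, mul_one] at h2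
          exact h2
        · have : φ.1.val M (Sum.elim x₁ y₀) = μ₁ φ := congr_fun ht φ
          rw [hA]
          simpa [this] using hδ
  have e : Sum.elim (fun i => x (.inl i)) (fun i => x (.inr i)) = x := Sum.elim_comp_inl_inr x
  have h0 : chronType M (Sum.elim (fun i => x (.inl i)) y₀) = μ₀ := funext fun φ => by
    have := hx _ (.inr (.inl ⟨φ, rfl⟩))
    rw [hA] at this
    exact sub_eq_zero.1 this
  have h1 : chronType M (Sum.elim (fun i => x (.inr i)) y₀) = μ₁ := funext fun φ => by
    have := hx _ (.inr (.inr ⟨φ, rfl⟩))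
    rw [hA] at this
    exact sub_eq_zero.1 this
  have h2 := hx B (.inl rfl)
  rw [← e, hB] at h2
  have h3 := max_eq_left_iff.1 h2
  have h4 := hc _ _ ⟨fun i => (hxD (.inl i)).1, fun i => (hxD (.inr i)).1, h0, h1⟩
  linarith

/-- A definable predicate that vanishes at `μ₀` and measures by how much `‖x₀ - x₁‖₂²`, for `x₁` of
type `μ₁`, can fall below the minimum for couplings of `(μ₀, μ₁)`. -/
theorem exists_definable_majorant [Countable κ] (hsat : M.IsCountablySaturated)
    (hr : ∀ i, 0 < r i) (hy₀ : y₀ ∈ M.tuples κ)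
    (hc : ∀ x₀ x₁, IsCoupling M y₀ μ₀ μ₁ x₀ x₁ → c ≤ M.rip (x₀ - x₁) (x₀ - x₁)) :
    ∃ g : Predicate.{u} (Fin m ⊕ κ), IsChronDefinable g ∧
      (∀ x, chronType M (Sum.elim x y₀) = μ₀ → g M (Sum.elim x y₀) = 0) ∧
      ∀ x₀ ∈ M.ball r, ∀ x₁ ∈ M.ball r, chronType M (Sum.elim x₁ y₀) = μ₁ →
        c - M.rip (x₀ - x₁) (x₀ - x₁) ≤ g M (Sum.elim x₀ y₀) := by
  set C : ℝ := max c 1 with hC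
  have hC0 : 0 < C := lt_max_of_lt_right one_pos
  set a : ℕ → ℝ := fun n => C * (1 / 2) ^ n with ha
  have ha0 : ∀ n, 0 < a n := fun n => by positivity
  have has : Summable a := summable_geometric_two.mul_left C
  choose p hp hp0 hpμ hlt using fun n => exists_penalty hsat hr hy₀ hc (ha0 n)
  -- The index shift matters: a defect `f` with `a (k + 1) < f ≤ a k` forces `p (k + 1) ≥ 1`, so the
  -- `k`-th term alone contributes `a k ≥ f`. The choice `C ≥ c` ensures `f ≤ a 0`.
  set t : ℕ → Predicate.{u} (Fin m ⊕ κ) := fun n N v => a n * min (p (n + 1) N v) 1 with ht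
  have ht0 : ∀ n N v, 0 ≤ t n N v := fun n N v =>
    mul_nonneg (ha0 n).le (le_min (hp0 _ _ _) zero_le_one)
  have hta : ∀ n N v, t n N v ≤ a n := fun n N v =>
    mul_le_of_le_one_right (ha0 n).le (min_le_right _ _)
  refine ⟨fun N v => ∑' n, t n N v, isChronDefinable_tsum has (fun n => ?_) ht0 hta,
    fun x hx => ?_, fun x₀ hx₀ x₁ hx₁ hμ => ?_⟩
  · exact IsChronDefinable.const_mul _ ((hp (n + 1)).map (LipschitzWith.id.min_const 1))
  · simp [ht, hpμ _ x hx]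
  · set f := c - M.rip (x₀ - x₁) (x₀ - x₁) with hf
    have hfC : f ≤ a 0 := by
      have := M.rip_self_nonneg
        (M.sub_mem_tuples (M.ball_subset_tuples hx₀) (M.ball_subset_tuples hx₁))
      have := le_max_left c 1
      simp only [ha, pow_zero, mul_one]
      linarith
    rcases le_or_gt f 0 with h0 | h0
    · exact h0.trans (tsum_nonneg fun n => ht0 _ _ _)
    · have hex : ∃ n, a n < f :=
        (has.tendsto_atTop_zero.eventually (gt_mem_nhds h0)).exists
      classical
      obtain ⟨k, hk⟩ : ∃ k, Nat.find hex = k + 1 := Nat.exists_eq_succ_of_ne_zero fun h => by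
        have := Nat.find_spec hex
        rw [h] at this
        linarith
      have h1 : f ≤ a k := not_lt.1 (Nat.find_min hex (by omega))
      have h2 : a (k + 1) < f := hk ▸ Nat.find_spec hex
      have h3 : 1 ≤ p (k + 1) M (Sum.elim x₀ y₀) := by
        by_contra! h
        exact absurd (hlt (k + 1) x₀ hx₀ x₁ hx₁ hμ h) (not_le.2 h2)
      have hs : Summable fun n => t n M (Sum.elim x₀ y₀) :=
        has.of_nonneg_of_le (fun n => ht0 n _ _) fun n => hta n _ _
      have h4 := hs.le_tsum k fun n _ => ht0 _ _ _
      simp only [ht, min_eq_right h3, mul_one] at h4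
      exact h1.trans h4

end

/-! ### Dual potentials and the proof of the theorem -/

theorem exists_dual_potentials {M : FiltModel.{u}} (hM : M.IsStatModel)
    (hsat : M.IsCountablySaturated) {m : ℕ} {κ : Type} [Countable κ] {y₀ : κ → M.Op}
    (hy₀ : y₀ ∈ M.tuples κ) {r : Fin m → ℝ≥0} (hr : ∀ i, 0 < r i)
    {μ₀ μ₁ : ChronFormula (Fin m ⊕ κ) → ℝ} (hμ₀ : μ₀ ∈ typesOver M r y₀)
    (hμ₁ : μ₁ ∈ typesOver M r y₀) :
    ∃ (L : ℝ≥0) (Ψ : Predicate.{u} (Fin m ⊕ κ)), 0 < L ∧ IsChronDefinable Ψ ∧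
      IsDualLipschitz L Ψ ∧ ∀ x₀ x₁, IsOptimalCoupling M y₀ μ₀ μ₁ x₀ x₁ →
        Ψ M (Sum.elim x₁ y₀) ≤ 0 ∧ ∀ x ∈ M.tuples (Fin m),
          (M.rip (x₀ - x₁) (x₀ - x₁) - M.rip (x - x₀) (x - x₀)) / 2 ≤ Ψ M (Sum.elim x y₀) := by
  set c : ℝ := wassersteinDist M y₀ μ₀ μ₁ ^ 2 with hc
  have hW0 : 0 ≤ wassersteinDist M y₀ μ₀ μ₁ := Real.sInf_nonneg (by
    rintro _ ⟨_, _, -, rfl⟩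
    exact Real.sqrt_nonneg _)
  have hcc : ∀ x₀ x₁, IsCoupling M y₀ μ₀ μ₁ x₀ x₁ → c ≤ M.rip (x₀ - x₁) (x₀ - x₁) := by
    intro x₀ x₁ h
    rw [hc, ← M.tupleNorm2_sq (M.sub_mem_tuples h.1 h.2.1)]
    refine pow_le_pow_left₀ hW0 (csInf_le ⟨0, ?_⟩ ⟨x₀, x₁, h, rfl⟩) 2
    rintro _ ⟨_, _, -, rfl⟩
    exact Real.sqrt_nonneg _
  obtain ⟨g, hg, hgμ, hgle⟩ := exists_definable_majorant hsat hr hy₀ hcc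
  -- Large enough that differences of tuples in the ball of radii `r` lie where the Huber function
  -- is quadratic; the `+ 1` keeps `L` positive when `m = 0`.
  set L : ℝ≥0 := 2 * ∑ i, r i + 1 with hL
  have hL0 : 0 < L := by positivity
  let K : Predicate.{u} ((Fin m ⊕ κ) ⊕ Fin m) := fun N v =>
    c / 2 - huber L N v -
      1 / 2 * g N (Sum.elim (fun i => v (.inr i)) fun j => v (.inl (.inr j)))
  have hK : IsChronDefinable K := by
    have h1 := hg.subst (β := (Fin m ⊕ κ) ⊕ Fin m)
      (Sum.elim (fun i => .var (.inr i)) fun j => .var (.inl (.inr j))) (by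
        rintro N v hv (i | j)
        exacts [hv _, hv _])
    refine (((IsChronDefinable.const (c / 2)).sub (isChronDefinable_huber hL0)).sub
      (h1.const_mul (1 / 2))).congr fun N _ v _ => ?_
    have e : (fun i => (Sum.elim (fun i : Fin m => PTerm.var (.inr i))
        (fun j : κ => PTerm.var (.inl (.inr j))) i : PTerm ((Fin m ⊕ κ) ⊕ Fin m)).eval N v) =
        Sum.elim (fun i => v (.inr i)) fun j => v (.inl (.inr j)) := by
      funext i
      rcases i with i | j <;> rfl
    rw [e]
  have hKe : ∀ (N : FiltModel.{u}) (x x₀ : Fin m → N.Op) (y : κ → N.Op),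
      K N (Sum.elim (Sum.elim x y) x₀) =
        c / 2 - huber L N (Sum.elim (Sum.elim x y) x₀) - 1 / 2 * g N (Sum.elim x₀ y) :=
    fun _ _ _ _ => rfl
  refine ⟨L, supBall r K, hL0, hK.supBall hr, fun N hN y hy x hx x' hx' => ?_,
    fun x₀ x₁ hopt => ?_⟩
  · refine supBall_le fun x₀ hx₀ => ?_
    have h1 := hK.le_supBall hr hN (N.elim_mem_tuples hx' hy) hx₀
    have h2 := huber_le_add hL0 hN hy hx' hx (N.ball_subset_tuples hx₀)
    rw [N.dualNorm_sub_comm hx' hx] at h2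
    rw [hKe] at h1 ⊢
    linarith
  · obtain ⟨⟨hx₀, hx₁, ht₀, ht₁⟩, hW⟩ := hopt
    obtain ⟨w₀, hw₀, e₀⟩ := hμ₀
    obtain ⟨w₁, hw₁, e₁⟩ := hμ₁
    -- Couplings are only required to lie in `M 0`; their types place them in the ball over which
    -- the supremum and the bound by `g` are taken.
    have hx₀r := mem_ball_of_chronType_eq hsat hr hw₀ hx₀ (ht₀.trans e₀.symm)
    have hx₁r := mem_ball_of_chronType_eq hsat hr hw₁ hx₁ (ht₁.trans e₁.symm)
    have hcx : M.rip (x₀ - x₁) (x₀ - x₁) = c := by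
      rw [← M.tupleNorm2_sq (M.sub_mem_tuples hx₀ hx₁), hW]
    refine ⟨supBall_le fun x hx => ?_, fun x hx => ?_⟩
    · have hxt := M.ball_subset_tuples hx
      have hball : x₁ - x ∈ M.ball fun _ => L := fun i => by
        refine ⟨sub_mem (hx₁ i) (hxt i), ?_⟩
        have h1 := (hx₁r i).2
        have h2 := (hx i).2
        have h3 := norm_sub_le (x₁ i) (x i)
        have h4 : (r i : ℝ) ≤ ((∑ i, r i : ℝ≥0) : ℝ) :=
          NNReal.coe_le_coe.2 (Finset.single_le_sum (fun _ _ => zero_le) (Finset.mem_univ i))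
        simp only [Pi.sub_apply, hL, NNReal.coe_add, NNReal.coe_mul, NNReal.coe_ofNat,
          NNReal.coe_one]
        linarith
      have h1 := half_sq_le_huber hL0 hM hy₀ hx₁ hxt hball
      have h2 := hgle x hx x₁ hx₁r ht₁
      rw [← neg_sub x₁ x, M.rip_neg_left, M.rip_neg_right, neg_neg] at h2
      rw [hKe]
      linarith
    · have h1 := hK.le_supBall hr hM (M.elim_mem_tuples hx hy₀) hx₀r
      have h2 := huber_le_half_sq (L := L) (y := y₀) hx hx₀
      rw [hKe, hgμ x₀ ht₀] at h1
      rw [hcx]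
      linarith

end NCProc

end

theorem mainTheorem5 (M : NCProc.FiltModel.{u}) (hM : M.IsStatModel)
    (hsat : M.IsCountablySaturated) (m : ℕ) (m' : ℕ∞)
    (y₀ : NCProc.Idx m' → M.Op) (hy₀ : y₀ ∈ M.tuples (NCProc.Idx m'))
    (r : Fin m → NNReal) (hr : ∀ i, 0 < r i)
    (μ₀ μ₁ : NCProc.ChronFormula (Fin m ⊕ NCProc.Idx m') → ℝ)
    (hμ₀ : μ₀ ∈ NCProc.typesOver M r y₀) (hμ₁ : μ₁ ∈ NCProc.typesOver M r y₀) :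
    ∃ Φ₀ Φ₁ : NCProc.Predicate.{u} (Fin m ⊕ NCProc.Idx m'),
      NCProc.IsChronDefinable Φ₀ ∧ NCProc.IsChronDefinable Φ₁ ∧
      (∀ N : NCProc.FiltModel.{u}, N.IsStatModel →
        ∀ x₀ ∈ N.tuples (Fin m), ∀ x₁ ∈ N.tuples (Fin m), ∀ y ∈ N.tuples (NCProc.Idx m'),
          (N.ip x₀ x₁).re ≤ Φ₀ N (Sum.elim x₀ y) + Φ₁ N (Sum.elim x₁ y)) ∧
      (∀ x₀ x₁ : Fin m → M.Op, NCProc.IsOptimalCoupling M y₀ μ₀ μ₁ x₀ x₁ →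
        Φ₀ M (Sum.elim x₀ y₀) + Φ₁ M (Sum.elim x₁ y₀) = (M.ip x₀ x₁).re) ∧
      NCProc.IsConvexInFirst Φ₀ ∧ NCProc.IsConvexInFirst Φ₁ ∧
      NCProc.IsLipschitzPlusQuadratic Φ₀ ∧ NCProc.IsLipschitzPlusQuadratic Φ₁ := by
  obtain ⟨L, Ψ, hL, hΨ, hLip, hopt⟩ := NCProc.exists_dual_potentials hM hsat hy₀ hr hμ₀ hμ₁
  have hΨ₀ := hΨ.transform hL
  have hLip₀ := hLip.transform hL hΨ
  have hΨ₁ := hΨ₀.transform hL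
  have hLip₁ := hLip₀.transform hL hΨ₀
  have hge : ∀ N : NCProc.FiltModel.{u}, N.IsStatModel →
      ∀ x₀ ∈ N.tuples (Fin m), ∀ x₁ ∈ N.tuples (Fin m), ∀ y ∈ N.tuples (NCProc.Idx m'),
        (N.ip x₀ x₁).re ≤ NCProc.addQuadratic (NCProc.transform L Ψ) N (Sum.elim x₀ y) +
          NCProc.addQuadratic (NCProc.transform L (NCProc.transform L Ψ)) N (Sum.elim x₁ y) := by
    intro N hN x₀ hx₀ x₁ hx₁ y hy
    have h1 := hLip₀.le_transform hL hΨ₀ hN hy hx₁ (N.sub_mem_tuples hx₀ hx₁)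
    rw [add_sub_cancel, N.rip_sub_self hx₀ hx₁] at h1
    rw [NCProc.addQuadratic_elim hx₀, NCProc.addQuadratic_elim hx₁]
    change N.rip x₀ x₁ ≤ _
    linarith
  refine ⟨_, _, hΨ₀.addQuadratic, hΨ₁.addQuadratic, hge, fun x₀ x₁ h => ?_,
    hLip.isConvexInFirst hL hΨ, hLip₀.isConvexInFirst hL hΨ₀,
    NCProc.isLipschitzPlusQuadratic_addQuadratic hLip₀ hΨ₀,
    NCProc.isLipschitzPlusQuadratic_addQuadratic hLip₁ hΨ₁⟩
  have hx₀ := h.1.1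
  have hx₁ := h.1.2.1
  obtain ⟨h1, h2⟩ := hopt x₀ x₁ h
  refine le_antisymm ?_ (hge M hM x₀ hx₀ x₁ hx₁ y₀ hy₀)
  have h3 := NCProc.transform_transform_le hL hΨ hM hy₀ hx₁
  -- The lower bound on `Ψ` at `x₀ + k` cancels `-‖k‖₂²/2` exactly. With `Ψ ≤ 0` at `x₁` the two
  -- transforms sum to at most `-‖x₀ - x₁‖₂²/2`, and adding `q(x₀) + q(x₁)` leaves `Re ⟨x₀, x₁⟩`.
  have h4 : NCProc.transform L Ψ M (Sum.elim x₀ y₀) ≤ -(M.rip (x₀ - x₁) (x₀ - x₁)) / 2 := by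
    refine NCProc.transform_le fun k hk => ?_
    have := h2 _ (M.add_mem_tuples hx₀ (M.ball_subset_tuples hk))
    rw [add_sub_cancel_left] at this
    linarith
  rw [M.rip_sub_self hx₀ hx₁] at h4
  rw [NCProc.addQuadratic_elim hx₀, NCProc.addQuadratic_elim hx₁]
  change _ ≤ M.rip x₀ x₁
  linarith
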